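/- **Definitions.** Points of $[0,1]^d$ have coordinates $x_0,\dots,x_{d-1}$. A scanning order is given by a set of rules; each rule has a unit region, subdivides it into an ordered sequence of subregions, and prescribes the order within each subregion by a rule transformed by rotation, reflection, scaling, translation and possibly reversal of the order of traversal. It is *2-regular* if the unit region of every rule is $[0,1]^d$ and every rule subdivides it into the $2^d$ subcubes of width $1/2$; it is a *mono-curve* if there is only one rule; a mono-curve is *order-preserving* if no reversals are used. It is *vertex-continuous* if, whenever two cells $C, C'$ of the same recursion depth are visited consecutively and both are refined recursively to the same depth $\ell\ge 1$, the last cell within $C$ shares a point with the first cell within $C'$. A scanning order *defines* a curve $f$ if for every recursion depth, with cells $C_1,\dots,C_n$ in order, $f$ maps the interval $\left[\frac{\mathrm{vol}(C_1)+\dots+\mathrm{vol}(C_{i-1})}{\mathrm{vol}(C_1)+\dots+\mathrm{vol}(C_n)},\frac{\mathrm{vol}(C_1)+\dots+\mathrm{vol}(C_i)}{\mathrm{vol}(C_1)+\dots+\mathrm{vol}(C_n)}\right]$ onto $C_i$, for all $i$. It has *neutral orientation* if, as the recursion depth $\ell$ tends to infinity, the fraction of the cells of depth $\ell$ in which the copy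 of the curve has its axes permuted according to $\pi$ (axis $\pi(i)$ of the whole curve is mapped to axis $i$) tends to $1/d!$, for each permutation $\pi$ of $\{0,\dots,d-1\}$. A *space-filling curve* in $d$ dimensions is a continuous surjection $f:[0,1]\to[0,1]^d$. A *valid ordering* of $f$ is a map $g:[0,1]^d\to[0,1]$ with $f(g(p))=p$ for all $p$. For a strictly increasing $\mu:\{0,\dots,d'-1\}\to\{0,\dots,d-1\}$ and $p\in[0,1]^{d'}$, let $\mu(p)\in[0,1]^d$ be the point with coordinate $p_i$ at position $\mu(i)$ for each $i$, and zeros elsewhere. A $d$-dimensional $f$ is *extradimensional* to a $d'$-dimensional $f'$, where $d'<d$, if for every valid ordering $g'$ of $f'$ and every $\mu$ there is a valid ordering $g$ of $f$ with $g'(a)<g'(b)\Leftrightarrow g(\mu(a))<g(\mu(b))$ for all $a,b\in[0,1]^{d'}$. A set of space-filling curves is *interdimensionally consistent* if it contains a unique $d$-dimensional curve $f_d$ for every $d\ge 1$, and $f_j$ is extradimensional to $f_i$ whenever $j>i\ge 1$. For $d\ge2$, a $d$-dimensional curve $f$ *shows* a $(d-1)$-dimensional curve $h$ on the face $F^k_i=\{x\in[0,1]^d: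 x_i=k\}$, $k\in\{0,1\}$, if for every valid ordering $e$ of $h$ there is a valid ordering $g$ of $f$ whose visible order on $F^k_i$ is $e$, that is: for all $a,b\in F^k_i$, with $a^\ast,b^\ast$ obtained by deleting coordinate $i$, $e(a^\ast)<e(b^\ast)\Leftrightarrow g(a)<g(b)$, and the set $\{p: s\le e(p)\le t\}$ has measure $t-s$ for $0\le s\le t\le 1$. *Harmonious Hilbert curves.* Let $d\ge1$, and write a rank $r\in\{0,\dots,2^d-1\}$ in binary as $r_0r_1\dots r_{d-1}$, with $r_0$ the most significant digit. Let $c(r)\in\{0,1\}^d$ be the $r$-th element (counting from zero) of the $d$-digit binary reflected Gray code, where the $(d+1)$-digit code consists of the $d$-digit code with each element prefixed by $0$, followed by the reverse of the $d$-digit code with each element prefixed by $1$, and the $1$-digit code is $0,1$. Let $a_i(r)=\#\{j>i: r_j\ne r_{d-1}\}$ if $r_i\neq r_{d-1}$, and $a_i(r)=d-1-\#\{j<i: r_j=r_{d-1}\}$ if $r_i=r_{d-1}$. Let $m_i(0)=c_i(0)$ and, for $r>0$, $m_{d-1}(r)=1-c_{d-1}(r)$ and $m_i(r)=c_i(r-1)$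 for $i<d-1$. The $d$-dimensional harmonious Hilbert scanning order has a single rule: it visits the $2^d$ subcubes $S(r)$ of $[0,1]^d$ in the order $r=0,\dots,2^d-1$, where $S(r)$ is the subcube with lowest corner $\frac12c(r)$, and the order within $S(r)$ is the image of the whole order under $p\mapsto q$, with $q_i=\frac12\left(c_i(r)+p_{a_i(r)}\right)$ if $m_i(r)=0$ and $q_i=\frac12\left(c_i(r)+1-p_{a_i(r)}\right)$ if $m_i(r)=1$. **Theorem.** (1) For every $d\ge1$, the $d$-dimensional harmonious Hilbert scanning order is a 2-regular, order-preserving, vertex-continuous mono-curve (thus, a mono-Hilbert curve) with neutral orientation. (2) For every $d\ge1$, it defines a unique space-filling curve $f_d$, and the set $\{f_d : d\ge1\}$ is interdimensionally consistent: $f_j$ is extradimensional to $f_i$ whenever $j>i\ge1$. (3) For every $d\ge2$, $f_d$ shows $f_{d-1}$ on each front face $F^0_i$, $0\le i\le d-1$, and on each back face $F^1_i$ with $0\le i<d-1$ it shows $f_{d-1}$ mirrored in dimension $i$ (that is, with coordinate $i$ replaced by one minus itself). -/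

import Mathlib

open Filter Topology MeasureTheory unitInterval

namespace SpaceFilling

/-! ## Scanning orders given by rule systems -/

/-- The transformation `x ↦ scale • (rot x) + shift` of `ℝᵈ`, where `rot` is an orthogonal matrix
(a composition of rotations and reflections). -/
structure Similarity (d : ℕ) where
  scale : ℝ
  scale_pos : 0 < scale
  rot : Matrix.orthogonalGroup (Fin d) ℝ
  shift : Fin d → ℝ

namespace Similarity

variable {d : ℕ}

/-- The underlying map of a similarity. -/
def app (T : Similarity d) (x : Fin d → ℝ) : Fin d → ℝ :=
  T.scale • Matrix.mulVec (T.rot : Matrix (Fin d) (Fin d) ℝ) x + T.shift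

/-- The identity. -/
def refl (d : ℕ) : Similarity d := ⟨1, one_pos, 1, 0⟩

/-- `T.comp U` first applies `U` and then `T`. -/
def comp (T U : Similarity d) : Similarity d :=
  ⟨T.scale * U.scale, mul_pos T.scale_pos U.scale_pos, T.rot * U.rot, T.app U.shift⟩

theorem app_refl (x : Fin d → ℝ) : (refl d).app x = x := by
  simp [app, refl]

theorem app_comp (T U : Similarity d) (x : Fin d → ℝ) :
    (T.comp U).app x = T.app (U.app x) := by
  simp [app, comp, Matrix.mulVec_add, Matrix.mulVec_smul, smul_smul, add_assoc]

end Similarity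

/-- A scanning order in `d` dimensions. Each rule `s` has a unit region, which is subdivided into
`num s` subregions, numbered in the order in which they are visited. The order within subregion
`j` is obtained from the rule `next s j` by means of the transformation `trans s j`, with the
direction of traversal reversed if `reversed s j` is true. The scanning order starts with the rule
`start`. -/
structure ScanningOrder (d : ℕ) where
  Rule : Type
  start : Rule
  unitRegion : Rule → Set (Fin d → ℝ)
  num : Rule → ℕ
  next : (s : Rule) → Fin (num s) → Rule
  trans : (s : Rule) → Fin (num s) → Similarity d
  reversed : (s : Rule) → Fin (num s) → Bool

/-- The unit hypercube `[0,1]ᵈ` as a subset of `ℝᵈ`. -/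
def unitCube (d : ℕ) : Set (Fin d → ℝ) := Set.Icc 0 1

/-- The cell with location `c` in the grid of `kᵈ` hypercubes of width `1/k` in `[0,1]ᵈ`. -/
def gridCell {d : ℕ} (k : ℕ) (c : Fin d → Fin k) : Set (Fin d → ℝ) :=
  {x | ∀ i, ((c i : ℕ) : ℝ) / k ≤ x i ∧ x i ≤ (((c i : ℕ) : ℝ) + 1) / k}

namespace ScanningOrder

variable {d : ℕ} (S : ScanningOrder d)

/-- The `j`-th subregion of the unit region of rule `s`. -/
def subregion (s : S.Rule) (j : Fin (S.num s)) : Set (Fin d → ℝ) :=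
  (S.trans s j).app '' S.unitRegion (S.next s j)

/-- The unit region of each rule is the unit hypercube, and each rule subdivides it into the `kᵈ`
hypercubes of width `1/k`, each of which is visited exactly once. -/
def IsRegular (k : ℕ) : Prop :=
  ∀ s, S.unitRegion s = unitCube d ∧
    ∃ c : Fin (S.num s) ≃ (Fin d → Fin k), ∀ j, S.subregion s j = gridCell k (c j)

/-- The rule system contains only a single rule. -/
def IsMono : Prop := Nat.card S.Rule = 1

/-- A mono-curve without reversals: the transformations consist of rotations and reflections,
together with the scaling and translation that put the copies into place. -/
def IsOrderPreserving : Prop := S.IsMono ∧ ∀ s j, S.reversed s j = false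

/-- A transformed, possibly reversed, copy of a rule, as it occurs when expanding the recursion. -/
structure Piece where
  rule : S.Rule
  map : Similarity d
  rev : Bool

variable {S}

/-- The region occupied by a piece. -/
def Piece.region (P : S.Piece) : Set (Fin d → ℝ) := P.map.app '' S.unitRegion P.rule

/-- The subregions of a piece, in the order in which they are visited. -/
def Piece.refine (P : S.Piece) : List S.Piece :=
  let L := (List.finRange (S.num P.rule)).map fun j =>
    (⟨S.next P.rule j, P.map.comp (S.trans P.rule j), xor P.rev (S.reversed P.rule j)⟩ : S.Piece)
  if P.rev then L.reverse else L

/-- The pieces, in order, that result from refining a piece recursively to depth `l`. -/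
def Piece.refineN (P : S.Piece) : ℕ → List S.Piece
  | 0 => [P]
  | l + 1 => (P.refineN l).flatMap Piece.refine

variable (S)

/-- The pieces of recursion depth `l`, in the order in which they are visited. -/
def pieces (l : ℕ) : List S.Piece :=
  (⟨S.start, Similarity.refl d, false⟩ : S.Piece).refineN l

/-- Whenever `P` and `Q` are visited consecutively and both are refined to any depth `l ≥ 1`, the
last cell within `P` shares a point with the first cell within `Q`. -/
def IsVertexContinuous : Prop :=
  ∀ h l : ℕ, 1 ≤ l → List.IsChain
    (fun P Q : S.Piece => ∃ A ∈ (P.refineN l).getLast?, ∃ B ∈ (Q.refineN l).head?,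
      (A.region ∩ B.region).Nonempty) (S.pieces h)

/-- The permutation `π` is the rotation component of the transformation of a piece: in row `i`, the
only non-zero entry of the matrix is in column `π i`, that is, axis `π i` of the curve as a whole is
mapped to axis `i` within the piece. -/
def HasRotation {S : ScanningOrder d} (π : Equiv.Perm (Fin d)) (P : S.Piece) : Prop :=
  ∀ i j, (P.map.rot : Matrix (Fin d) (Fin d) ℝ) i j ≠ 0 ↔ j = π i

open Classical in
/-- In the limit for increasing recursion depth, all `d!` permutations are equally frequent as
rotation components of the pieces. -/
def HasNeutralOrientation : Prop :=
  ∀ π : Equiv.Perm (Fin d), Tendsto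
    (fun l : ℕ => (((S.pieces l).countP fun P => decide (HasRotation π P) : ℕ) : ℝ) /
      ((S.pieces l).length : ℝ))
    atTop (𝓝 (1 / (Nat.factorial d : ℝ)))

/-- The volume of the first `i` cells of recursion depth `l`, relative to the volume of all cells of
recursion depth `l`. -/
noncomputable def relVolume (l i : ℕ) : ℝ :=
  (((S.pieces l).take i).map fun P => volume.real P.region).sum /
    ((S.pieces l).map fun P => volume.real P.region).sum

end ScanningOrder

/-! ## Space-filling curves -/

/-- A continuous surjective map from `[0,1]` to `[0,1]ᵈ`. -/
structure Curve (d : ℕ) where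
  toFun : I → (Fin d → I)
  continuous_toFun : Continuous toFun
  surjective_toFun : Function.Surjective toFun

/-- The scanning order `S` defines the curve `f`: at each level of recursion, `f` maps the interval
from `relVolume l i` to `relVolume l (i + 1)` onto cell number `i` (counting from zero). -/
def ScanningOrder.Defines {d : ℕ} (S : ScanningOrder d) (f : Curve d) : Prop :=
  ∀ (l i : ℕ) (hi : i < (S.pieces l).length),
    f.toFun '' {t | S.relVolume l i ≤ (t : ℝ) ∧ (t : ℝ) ≤ S.relVolume l (i + 1)} =
      {x | (fun j => (x j : ℝ)) ∈ ((S.pieces l)[i]).region}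

namespace Curve

variable {d d' : ℕ}

/-- A valid ordering of `f` assigns to every point `p` of the hypercube a time at which `f`
visits `p`. -/
def IsValidOrdering (f : Curve d) (g : (Fin d → I) → I) : Prop := ∀ p, f.toFun (g p) = p

/-- Insert zero coordinates at the positions that are not selected by `μ`. -/
noncomputable def lift (μ : Fin d' → Fin d) (p : Fin d' → I) : Fin d → I :=
  Function.extend μ p 0

/-- The `d`-dimensional curve `f` is extradimensional to the `d'`-dimensional curve `f'`. -/
def IsExtradimensional (f : Curve d) (f' : Curve d') : Prop :=
  ∀ g', f'.IsValidOrdering g' → ∀ μ : Fin d' → Fin d, StrictMono μ →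
    ∃ g, f.IsValidOrdering g ∧ ∀ a b, g' a < g' b ↔ g (lift μ a) < g (lift μ b)

/-- The curve `f` mirrored in dimension `i`. -/
def mirror (f : Curve d) (i : Fin d) : Curve d where
  toFun t := Function.update (f.toFun t) i (σ (f.toFun t i))
  continuous_toFun := f.continuous_toFun.update i
    (unitInterval.continuous_symm.comp ((continuous_apply i).comp f.continuous_toFun))
  surjective_toFun p := by
    obtain ⟨t, ht⟩ := f.surjective_toFun (Function.update p i (σ (p i)))
    exact ⟨t, by simp [ht]⟩

/-- `e` is the visible order of `g` on the face of points whose `i`-th coordinate is `k`. Here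
`i.removeNth a` is the point `a` with its `i`-th coordinate removed. -/
def IsVisibleOrder {n : ℕ} (g : (Fin (n + 1) → I) → I) (i : Fin (n + 1)) (k : I)
    (e : (Fin n → I) → I) : Prop :=
  (∀ a b : Fin (n + 1) → I, a i = k → b i = k →
    (e (i.removeNth a) < e (i.removeNth b) ↔ g a < g b)) ∧
  ∀ s t : I, s ≤ t → volume {p | s ≤ e p ∧ e p ≤ t} = ENNReal.ofReal ((t : ℝ) - s)

/-- The curve `g` shows the curve `f` on the face of points whose `i`-th coordinate is `k`: every
valid ordering of `f` is the visible order on this face of some valid ordering of `g`. -/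
def Shows {n : ℕ} (g : Curve (n + 1)) (f : Curve n) (i : Fin (n + 1)) (k : I) : Prop :=
  ∀ e, f.IsValidOrdering e → ∃ o, g.IsValidOrdering o ∧ IsVisibleOrder o i k e

end Curve

/-- The set of space-filling curves whose `d`-dimensional members are `F d` contains a unique
`d`-dimensional curve for each `d ≥ 1`, and each of its curves is extradimensional to each of its
lower-dimensional curves. -/
def InterdimensionallyConsistent (F : (d : ℕ) → Set (Curve d)) : Prop :=
  (∀ d, 1 ≤ d → ∃! f, f ∈ F d) ∧
    ∀ i j, 1 ≤ i → i < j → ∀ f ∈ F j, ∀ f' ∈ F i, f.IsExtradimensional f'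

/-! ## The harmonious Hilbert curves -/

/-- The reflected Gray code with base `k`, as a sequence of `d`-digit numbers, with the most
significant digit at index `0`. -/
def grayCode (k : ℕ) : (d : ℕ) → List (Fin d → Fin k)
  | 0 => [Fin.elim0]
  | d + 1 => (List.finRange k).flatMap fun a : Fin k =>
      (if Even (a : ℕ) then grayCode k d else (grayCode k d).reverse).map
        fun c => (Fin.cons a c : Fin (d + 1) → Fin k)

theorem length_grayCode (k d : ℕ) : (grayCode k d).length = k ^ d := by
  induction d with
  | zero => simp [grayCode]
  | succ d ih =>
    have h : ∀ a : Fin k, ((if Even (a : ℕ) then grayCode k d else (grayCode k d).reverse).map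
        fun c => (Fin.cons a c : Fin (d + 1) → Fin k)).length = k ^ d := by
      intro a
      split_ifs <;> simp [ih]
    simp only [grayCode, List.length_flatMap, h]
    simp [pow_succ, mul_comm]

namespace Harmonious

variable {d : ℕ}

/-- Digit `i` of the `d`-digit binary number `r`; digit `0` is the most significant one, and digit
`d - 1` is the least significant one. -/
def digit (d r i : ℕ) : ℕ := r / 2 ^ (d - 1 - i) % 2

/-- The location of the subregion of rank `r`. -/
def loc (r : Fin (2 ^ d)) : Fin d → Fin 2 :=
  (grayCode 2 d)[(r : ℕ)]'(by rw [length_grayCode]; exact r.isLt)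

/-- The permutation of the subregion of rank `r`: axis `permFun r i` of the curve as a whole is
mapped to axis `i` within the subregion. -/
def permFun (r : Fin (2 ^ d)) (i : Fin d) : Fin d :=
  if digit d r i ≠ digit d r (d - 1) then
    ⟨(Finset.univ.filter fun j : Fin d => i < j ∧ digit d r j ≠ digit d r (d - 1)).card, by
      refine lt_of_lt_of_eq (Finset.card_lt_univ_of_notMem (x := i) ?_) (Fintype.card_fin d)
      simp⟩
  else
    ⟨d - 1 - (Finset.univ.filter fun j : Fin d => j < i ∧ digit d r j = digit d r (d - 1)).card, by
      have := i.isLt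
      omega⟩

theorem permFun_injective (r : Fin (2 ^ d)) : Function.Injective (permFun r) := by
  have key : ∀ i j : Fin d, i < j → permFun r i ≠ permFun r j := by
    intro i j hij h
    set l := digit d r (d - 1) with hl
    have hv := congrArg Fin.val h
    unfold permFun at hv
    simp only [← hl] at hv
    set A := fun i : Fin d => Finset.univ.filter fun j : Fin d => i < j ∧ digit d r j ≠ l
    set B := fun i : Fin d => Finset.univ.filter fun j : Fin d => j < i ∧ digit d r j = l
    have hAB : ∀ x y : Fin d, digit d r x ≠ l → digit d r y = l →
        (A x).card + (B y).card + 2 ≤ d := by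
      intro x y hx hy
      have hxy : x ≠ y := fun e => hx (e ▸ hy)
      have h1 : Disjoint (A x) (B y) := by
        rw [Finset.disjoint_left]
        intro z hz hz'
        simp only [A, B, Finset.mem_filter] at hz hz'
        exact hz.2.2 hz'.2.2
      have h2 : Disjoint (A x ∪ B y) {x, y} := by
        rw [Finset.disjoint_left]
        intro z hz hz'
        simp only [A, B, Finset.mem_union, Finset.mem_filter, Finset.mem_insert,
          Finset.mem_singleton] at hz hz'
        rcases hz' with rfl | rfl
        · rcases hz with hz | hz
          · exact lt_irrefl _ hz.2.1
          · exact hx hz.2.2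
        · rcases hz with hz | hz
          · exact hz.2.2 hy
          · exact lt_irrefl _ hz.2.1
      have h3 := Finset.card_le_univ (A x ∪ B y ∪ {x, y})
      rw [Finset.card_union_of_disjoint h2, Finset.card_union_of_disjoint h1,
        Finset.card_pair hxy, Fintype.card_fin] at h3
      exact h3
    by_cases hi : digit d r i ≠ l <;> by_cases hj : digit d r j ≠ l
    · rw [if_pos hi, if_pos hj] at hv
      have : (A j).card < (A i).card := by
        apply Finset.card_lt_card
        rw [Finset.ssubset_iff_of_subset]
        · exact ⟨j, by simp [A, hij, hj], by simp [A]⟩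
        · intro z hz
          simp only [A, Finset.mem_filter] at hz ⊢
          exact ⟨hz.1, hij.trans hz.2.1, hz.2.2⟩
      exact absurd hv (ne_of_gt this)
    · rw [if_pos hi, if_neg hj] at hv
      have := hAB i j hi (not_not.mp hj)
      change (A i).card = d - 1 - (B j).card at hv
      omega
    · rw [if_neg hi, if_pos hj] at hv
      have := hAB j i hj (not_not.mp hi)
      change d - 1 - (B i).card = (A j).card at hv
      omega
    · rw [if_neg hi, if_neg hj] at hv
      change d - 1 - (B i).card = d - 1 - (B j).card at hv
      have h1 : (B i).card < (B j).card := by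
        apply Finset.card_lt_card
        rw [Finset.ssubset_iff_of_subset]
        · exact ⟨i, by simp [B, hij, not_not.mp hi], by simp [B]⟩
        · intro z hz
          simp only [B, Finset.mem_filter] at hz ⊢
          exact ⟨hz.1, hz.2.1.trans hij, hz.2.2⟩
      have h2 : (B j).card < d := by
        refine lt_of_lt_of_eq (Finset.card_lt_univ_of_notMem (x := j) ?_) (Fintype.card_fin d)
        simp [B]
      omega
  intro i j h
  rcases lt_trichotomy i j with hij | hij | hij
  · exact absurd h (key i j hij)
  · exact hij
  · exact absurd h.symm (key j i hij)

/-- `permFun r` as a permutation. -/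
noncomputable def perm (r : Fin (2 ^ d)) : Equiv.Perm (Fin d) :=
  Equiv.ofBijective (permFun r) (Finite.injective_iff_bijective.mp (permFun_injective r))

/-- The reflections of the subregion of rank `r`: the order within the subregion is reflected in a
plane orthogonal to axis `i` if and only if `reflection r i = 1`. -/
def reflection (r : Fin (2 ^ d)) (i : Fin d) : Fin 2 :=
  if (r : ℕ) = 0 then loc r i
  else if (i : ℕ) = d - 1 then 1 - loc r i
  else loc ⟨(r : ℕ) - 1, lt_of_le_of_lt (Nat.sub_le _ _) r.isLt⟩ i

/-- The matrix that first permutes the axes according to `perm r` and then reflects them according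
to `reflection r`. -/
noncomputable def matrix (r : Fin (2 ^ d)) : Matrix (Fin d) (Fin d) ℝ :=
  fun i j => if j = perm r i then (if reflection r i = 1 then -1 else 1) else 0

theorem matrix_mem (r : Fin (2 ^ d)) : matrix r ∈ Matrix.orthogonalGroup (Fin d) ℝ := by
  rw [Matrix.mem_orthogonalGroup_iff]
  ext i k
  rw [Matrix.mul_apply, Finset.sum_eq_single (perm r i)]
  · by_cases h : i = k
    · subst h
      simp [matrix]
      split_ifs <;> norm_num
    · simp [matrix, h]
  · intro j _ hj
    simp [matrix, hj]
  · simp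

/-- The transformation that maps the curve as a whole to the subregion of rank `r`. The shift is the
one for which the image of the unit hypercube is the grid cell with location `loc r`. -/
noncomputable def trans (r : Fin (2 ^ d)) : Similarity d where
  scale := 1 / 2
  scale_pos := by norm_num
  rot := ⟨matrix r, matrix_mem r⟩
  shift i := (((loc r i : ℕ) : ℝ) + ((reflection r i : ℕ) : ℝ)) / 2

end Harmonious

/-- The scanning order of the `d`-dimensional harmonious Hilbert curve. -/
noncomputable def harmoniousOrder (d : ℕ) : ScanningOrder d where
  Rule := Unit
  start := ()
  unitRegion _ := unitCube d
  num _ := 2 ^ d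
  next _ _ := ()
  trans _ r := Harmonious.trans r
  reversed _ _ := false

/-- The set of `d`-dimensional space-filling curves defined by the scanning order of the
`d`-dimensional harmonious Hilbert curve. -/
def harmoniousHilbert (d : ℕ) : Set (Curve d) := {f | (harmoniousOrder d).Defines f}

end SpaceFilling

/-!
The proof describes the rule of the harmonious Hilbert curve in terms of the binary digits of the
rank `r`, where axis `i` carries digit `d - 1 - i` (counted from the least significant one). The
Gray code has on axis `i` the sum modulo two of digits `d - 1 - i` and `d - i`. The permutation
sends each axis to its position in an order of the axes (`permFun_val`): the axes whose digit differs
from the last digit come before the others, each group in descending order. Modulo two,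
the reflections are the sum of the Gray code, the indicator of the last axis and, for even `r`, the
indicator of the axis that the permutation sends to `0` (`reflection_val`).

*Continuity.* The curve leads from the origin to the vertex adjacent to it along axis `0`, and each
subcube is entered at the vertex where the preceding one is left (`trans_succ_app_zero`). Thus
consecutive cells share a vertex at every depth (`cellMap_consecutive`), so the point common to the
nested cells visited at time `t` depends continuously on `t`. Since diameters of cells tend to zero,
there is exactly one curve that passes through the cells in the given order.

*Neutral orientation.* The fractions of the cells of depth `l` that have a given permutation evolve
by averaging over the translates by the permutations of the rule. Some products of two of these
permutations are the identity, a cycle of all axes, and a transposition of neighbours, so that every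
permutation is a product of `m` of them, for a suitable `m`
(`exists_range_perm_pow_eq_univ`). Therefore every `m` steps the range of the fractions shrinks by a
constant factor (`tendsto_average`).

*Faces.* Call a face visible if it is a front face or a back face that is not orthogonal to the last
axis. Inserting one suitable digit in `ρ` gives the rank of the subcube of the `(n+1)`-dimensional
cube that meets a given visible face in subcube `ρ` of the face. Within that subcube, the face lies
on another visible face of the transformed curve, and the transformation restricts to that of the
`n`-dimensional curve (`trans_faceRank`). The insertion of the digit preserves the order of ranks.
By recursion, an increasing map from times of the `n`-dimensional curve to times of the
`(n+1)`-dimensional curve translates one curve into the other one as seen on the face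
(`point_faceTime`, `faceTime_lt`). With this map, valid orderings carry over to the higher
dimension. Extradimensionality follows by adding one coordinate at a time. The visible orders fill
measure at unit speed, since the image of `[s, t]` is covered by cells of total volume close to
`t - s`, and the remaining points lie in the images of `[0, s]` and `[t, 1]`.
-/

namespace SpaceFilling
namespace Harmonious
variable {d : ℕ}

/-! ### Binary digits, Gray code, permutations and reflections -/

/-- The Boolean digit of the reflected Gray code of `r` that belongs to axis `i`. -/
def gray (d r i : ℕ) : Bool := xor (r.testBit (d - 1 - i)) (r.testBit (d - i))

theorem grayCode_two_succ (d : ℕ) : grayCode 2 (d + 1) =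
    (grayCode 2 d).map (Fin.cons 0) ++ (grayCode 2 d).reverse.map (Fin.cons 1) := by
  simp [grayCode, List.finRange_succ]

theorem grayCode_getElem (d r : ℕ) (h : r < (grayCode 2 d).length) (i : Fin d) :
    ((grayCode 2 d)[r] i : ℕ) = (gray d r i).toNat := by
  induction d generalizing r with
  | zero => exact i.elim0
  | succ d ih =>
    have hlen := length_grayCode 2 d
    have h' : r < 2 ^ (d + 1) := by rwa [length_grayCode] at h
    rw [List.getElem_of_eq (grayCode_two_succ d) h]
    simp only [List.getElem_append, List.length_map, hlen]
    split_ifs with hr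
    · rw [List.getElem_map]
      refine Fin.cases ?_ (fun i => ?_) i
      · simp [gray, Nat.testBit_lt_two_pow hr, Nat.testBit_lt_two_pow h']
      · have := i.isLt
        rw [Fin.cons_succ, ih r (by omega)]
        simp only [gray, Fin.val_succ]
        congr 3 <;> omega
    · rw [List.getElem_map, List.getElem_reverse]
      refine Fin.cases ?_ (fun i => ?_) i
      · have : r.testBit d = true := by
          rw [Nat.testBit_eq_decide_div_mod_eq]
          have : r / 2 ^ d = 1 := by
            rw [Nat.div_eq_iff (by positivity)]; rw [pow_succ] at h'; omega
          simp [this]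
        simp [gray, this, Nat.testBit_lt_two_pow h']
      · have hi := i.isLt
        rw [Fin.cons_succ, ih _ (by omega)]
        have e : (grayCode 2 d).length - 1 - (r - 2 ^ d) = 2 ^ (d + 1) - (r + 1) := by
          rw [hlen]; rw [pow_succ] at h' ⊢; omega
        simp only [gray, e, Nat.testBit_two_pow_sub_succ h', Fin.val_succ]
        rw [decide_eq_true (by omega), decide_eq_true (by omega),
          show d + 1 - 1 - ((i : ℕ) + 1) = d - 1 - i by omega,
          show d + 1 - ((i : ℕ) + 1) = d - i by omega]
        simp

theorem loc_val (r : Fin (2 ^ d)) (i : Fin d) : (loc r i : ℕ) = (gray d r i).toNat :=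
  grayCode_getElem d r _ i

theorem digit_eq (r i : ℕ) : digit d r i = (r.testBit (d - 1 - i)).toNat := by
  rw [Nat.toNat_testBit]; rfl

/-- Axis `i` carries a binary digit of `r` that differs from the last digit of `r`. -/
def differs (r : Fin (2 ^ d)) (i : Fin d) : Prop :=
  (r : ℕ).testBit (d - 1 - i) ≠ (r : ℕ).testBit 0

instance (r : Fin (2 ^ d)) : DecidablePred (differs r) := fun _ => inferInstanceAs (Decidable (_ ≠ _))

theorem digit_ne_iff (r : Fin (2 ^ d)) (i : Fin d) :
    digit d r i ≠ digit d r (d - 1) ↔ differs r i := by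
  rw [digit_eq, digit_eq, differs]
  simp only [show d - 1 - (d - 1) = 0 by omega]
  cases (r : ℕ).testBit (d - 1 - i) <;> cases (r : ℕ).testBit 0 <;> simp

theorem digit_eq_iff (r : Fin (2 ^ d)) (i : Fin d) :
    digit d r i = digit d r (d - 1) ↔ ¬ differs r i := by
  rw [← digit_ne_iff, not_not]

/-- The linear order on the axes that is realised by `permFun r`: the axes whose digit differs from
the last one precede the others, and each of the two groups is listed in descending order. -/
def prec (r : Fin (2 ^ d)) (i j : Fin d) : Prop :=
  (differs r i ∧ ¬ differs r j) ∨ ((differs r i ↔ differs r j) ∧ j < i)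

instance (r : Fin (2 ^ d)) : DecidableRel (prec r) :=
  fun _ _ => inferInstanceAs (Decidable (_ ∨ _))

/-- `permFun r` sends each axis to its rank with respect to `prec r`. -/
theorem permFun_val (r : Fin (2 ^ d)) (j : Fin d) :
    (permFun r j : ℕ) = (Finset.univ.filter fun i => prec r i j).card := by
  unfold permFun
  simp only [digit_ne_iff, digit_eq_iff]
  split_ifs with h
  · dsimp only
    congr 1
    ext i
    simp [prec, h, and_comm]
  · have : (Finset.univ.filter fun i => prec r i j) =
        Finset.univ \ insert j (Finset.univ.filter fun i => i < j ∧ ¬ differs r i) := by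
      ext i
      simp only [prec, h, Finset.mem_filter, Finset.mem_univ, true_and, Finset.mem_sdiff,
        Finset.mem_insert, not_or]
      by_cases hi : differs r i
      · simp only [hi]
        simp
        rintro rfl; exact h hi
      · simp [hi]
        rw [lt_iff_le_and_ne]; tauto
    rw [this, Finset.card_sdiff_of_subset (Finset.subset_univ _),
      Finset.card_insert_of_notMem (by simp)]
    simp
    omega

theorem permFun_lt_iff (r : Fin (2 ^ d)) (i j : Fin d) : permFun r i < permFun r j ↔ prec r i j := by
  have key : ∀ i j, prec r i j → permFun r i < permFun r j := by
    intro i j h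
    rw [Fin.lt_def, permFun_val, permFun_val]
    apply Finset.card_lt_card
    rw [Finset.ssubset_iff_of_subset]
    · refine ⟨i, by simpa using h, ?_⟩
      rw [Finset.mem_filter]
      simp only [prec, lt_irrefl]
      tauto
    · intro k hk
      simp only [Finset.mem_filter, Finset.mem_univ, true_and] at hk ⊢
      simp only [prec] at hk h ⊢
      rcases hk with hk | hk <;> rcases h with h | h
      · tauto
      · tauto
      · tauto
      · exact Or.inr ⟨hk.1.trans h.1, h.2.trans hk.2⟩
  refine ⟨fun h => ?_, key i j⟩
  by_contra hc
  have hij : i ≠ j := by rintro rfl; exact lt_irrefl _ h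
  have : prec r j i := by
    simp only [prec] at hc ⊢
    rcases lt_or_gt_of_ne hij with hlt | hlt <;> tauto
  exact lt_asymm h (key _ _ this)

theorem permFun_val_eq_zero_iff (r : Fin (2 ^ d)) (j : Fin d) :
    (permFun r j : ℕ) = 0 ↔ ∀ i, ¬ prec r i j := by
  rw [permFun_val, Finset.card_eq_zero, Finset.filter_eq_empty_iff]
  simp

/-- The last axis is sent to `0` exactly if all digits of `r` are equal. -/
theorem permFun_last_eq_zero_iff (r : Fin (2 ^ d)) (j : Fin d) (hj : (j : ℕ) = d - 1) :
    (permFun r j : ℕ) = 0 ↔ ∀ p < d, (r : ℕ).testBit p = (r : ℕ).testBit 0 := by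
  rw [permFun_val_eq_zero_iff]
  have hd : ¬ differs r j := by simp [differs, hj]
  constructor
  · intro h p hp
    have := h ⟨d - 1 - p, by omega⟩
    by_contra hc
    apply this
    left
    refine ⟨?_, hd⟩
    simpa [differs, show d - 1 - (d - 1 - p) = p by omega] using hc
  · intro h i hi
    rcases hi with hi | hi
    · exact hi.1 (h _ (by have := i.isLt; omega))
    · have := i.isLt; have := hi.2; rw [Fin.lt_def] at this; omega

/-- Otherwise, the axis that is sent to `0` carries the lowest digit that differs from the last
one. -/
theorem permFun_eq_zero_iff (r : Fin (2 ^ d)) (j : Fin d) (hj : (j : ℕ) ≠ d - 1) :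
    (permFun r j : ℕ) = 0 ↔ (r : ℕ).testBit (d - 1 - j) ≠ (r : ℕ).testBit 0 ∧
      ∀ p < d - 1 - j, (r : ℕ).testBit p = (r : ℕ).testBit 0 := by
  rw [permFun_val_eq_zero_iff]
  have hjl := j.isLt
  constructor
  · intro h
    have hd : differs r j := by
      by_contra hc
      refine h ⟨d - 1, by omega⟩ (Or.inr ⟨?_, by rw [Fin.lt_def]; simp; omega⟩)
      simp only [hc, iff_false]
      simp [differs]
    refine ⟨hd, fun p hp => ?_⟩
    by_contra hc
    refine h ⟨d - 1 - p, by omega⟩ (Or.inr ⟨?_, by rw [Fin.lt_def]; simp; omega⟩)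
    simp only [hd, iff_true]
    simpa [differs, show d - 1 - (d - 1 - p) = p by omega] using hc
  · rintro ⟨h1, h2⟩ i hi
    rcases hi with hi | hi
    · exact hi.2 h1
    · have hl := i.isLt
      have hlt := hi.2
      rw [Fin.lt_def] at hlt
      exact (hi.1.mpr h1) (h2 _ (by omega))

/-- Decrementing a positive number flips exactly those digits below which there are only zeros. -/
theorem testBit_pred {r : ℕ} (hr : 0 < r) (j : ℕ) :
    (r - 1).testBit j = xor (r.testBit j) (decide (∀ p < j, r.testBit p = false)) := by
  induction j generalizing r with
  | zero =>
    simp [Nat.testBit_zero]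
    rcases Nat.mod_two_eq_zero_or_one r with h | h
    · have : (r - 1) % 2 = 1 := by omega
      simp [h, this]
    · have : (r - 1) % 2 = 0 := by omega
      simp [h, this]
  | succ j ih =>
    rw [Nat.testBit_succ, Nat.testBit_succ]
    have hall : (∀ p < j + 1, r.testBit p = false) ↔
        (r % 2 = 0 ∧ ∀ p < j, (r / 2).testBit p = false) := by
      constructor
      · intro h
        refine ⟨by simpa [Nat.testBit_zero] using h 0 (by omega), fun p hp => ?_⟩
        rw [← Nat.testBit_succ]; exact h _ (by omega)
      · rintro ⟨h0, h⟩ p hp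
        cases p with
        | zero => simp [Nat.testBit_zero, h0]
        | succ p => rw [Nat.testBit_succ]; exact h p (by omega)
    simp only [hall]
    rcases Nat.mod_two_eq_zero_or_one r with h | h
    · rw [show (r - 1) / 2 = r / 2 - 1 by omega, ih (by omega)]
      simp [h]
    · rw [show (r - 1) / 2 = r / 2 by omega]
      simp [h]

theorem gray_pred {r : ℕ} (hr : 0 < r) {i : ℕ} (hi : i < d) :
    gray d (r - 1) i = xor (gray d r i) (decide (r.testBit (d - 1 - i) = true ∧
      ∀ p < d - 1 - i, r.testBit p = false)) := by
  have e : d - i = (d - 1 - i) + 1 := by omega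
  simp only [gray, e, testBit_pred hr]
  have : (∀ p < d - 1 - i + 1, r.testBit p = false) ↔
      (r.testBit (d - 1 - i) = false ∧ ∀ p < d - 1 - i, r.testBit p = false) := by
    constructor
    · intro h; exact ⟨h _ (by omega), fun p hp => h p (by omega)⟩
    · rintro ⟨h0, h⟩ p hp
      rcases Nat.lt_succ_iff_lt_or_eq.mp hp with hp | rfl
      · exact h p hp
      · exact h0
  simp only [this]
  by_cases hz : ∀ p < d - 1 - i, r.testBit p = false
  · simp only [eq_true hz]
    cases r.testBit (d - 1 - i) <;> cases r.testBit (d - 1 - i + 1) <;> simp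
  · simp [hz]

/-- Whether the subcube of rank `r` is reflected along axis `i`. In place of the preceding element of
the Gray code, to which `reflection` refers, this description uses the axis that `permFun r` sends to
`0`; it treats all ranks and axes alike. -/
def reflBit (r : Fin (2 ^ d)) (i : Fin d) : Bool :=
  xor (gray d r i) (xor (decide ((i : ℕ) = d - 1))
    (decide ((r : ℕ).testBit 0 = false ∧ (permFun r i : ℕ) = 0)))

/-- For even `r > 0`, the Gray codes of `r - 1` and `r` differ on the axis of the lowest digit `1` of
`r`, which is the axis that `permFun r` sends to `0`. For odd `r` they differ on the last axis
only. -/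
theorem reflection_val (r : Fin (2 ^ d)) (i : Fin d) :
    (reflection r i : ℕ) = (reflBit r i).toNat := by
  have hil := i.isLt
  unfold reflection reflBit
  split_ifs with h0 hi
  · rw [loc_val]
    congr 1
    have : (i : ℕ) = d - 1 ↔ (permFun r i : ℕ) = 0 := by
      by_cases hi : (i : ℕ) = d - 1
      · simp only [hi, permFun_last_eq_zero_iff r i hi]
        simp [h0]
      · simp only [hi, permFun_eq_zero_iff r i hi]
        simp [h0]
    simp [this, h0]
  · have hne : ¬ ((r : ℕ).testBit 0 = false ∧ (permFun r i : ℕ) = 0) := by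
      rw [permFun_last_eq_zero_iff r i hi]
      rintro ⟨h1, h2⟩
      apply h0
      apply Nat.eq_of_testBit_eq
      intro p
      rw [Nat.zero_testBit]
      by_cases hp : p < d
      · rw [h2 p hp, h1]
      · exact Nat.testBit_lt_two_pow (lt_of_lt_of_le r.isLt (Nat.pow_le_pow_right (by norm_num) (by omega)))
    have h := loc_val r i
    rw [decide_eq_false hne, decide_eq_true hi]
    generalize hl : loc r i = c at h
    generalize gray d r i = b at h
    cases b <;> simp at h ⊢ <;> (fin_cases c <;> simp_all)
  · rw [loc_val, gray_pred (Nat.pos_of_ne_zero h0) hil, decide_eq_false hi]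
    congr 2
    rw [Bool.false_xor]
    rw [decide_eq_decide, permFun_eq_zero_iff r i hi]
    constructor
    · rintro ⟨h1, h2⟩
      have h3 := h2 0 (by omega)
      simp [h1, h3]
      exact h2
    · rintro ⟨h1, h2, h3⟩
      rw [h1] at h2 h3
      exact ⟨by simpa using h2, h3⟩

/-- The value of a Boolean as a real number. -/
def bval (b : Bool) : ℝ := if b then 1 else 0

/-- Reflection of a coordinate in `[0,1]`, if `b` is true. -/
def flip (b : Bool) (x : ℝ) : ℝ := if b then 1 - x else x

theorem flip_xor (a b : Bool) (x : ℝ) : flip (xor a b) x = flip a (flip b x) := by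
  cases a <;> cases b <;> simp [flip]

theorem trans_app (r : Fin (2 ^ d)) (x : Fin d → ℝ) (i : Fin d) :
    (trans r).app x i = (bval (gray d r i) + flip (reflBit r i) (x (permFun r i))) / 2 := by
  have hp : perm r i = permFun r i := rfl
  have h1 : Matrix.mulVec (matrix r) x i =
      (if reflection r i = 1 then -1 else 1) * x (permFun r i) := by
    rw [Matrix.mulVec, dotProduct, Finset.sum_eq_single (permFun r i)]
    · simp [matrix, hp]
    · intro j _ hj
      simp [matrix, hp, hj]
    · simp
  have h2 : (trans r).app x i = 1 / 2 * Matrix.mulVec (matrix r) x i +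
    (((loc r i : ℕ) : ℝ) + ((reflection r i : ℕ) : ℝ)) / 2 := rfl
  have h3 : reflection r i = 1 ↔ reflBit r i = true := by
    have := reflection_val r i
    generalize reflection r i = c at this
    generalize reflBit r i = b at this
    cases b <;> fin_cases c <;> simp_all
  simp only [h2, h1, h3, loc_val, reflection_val]
  cases reflBit r i <;> cases gray d r i <;> simp [bval, flip] <;> ring

/-! ### End points of the curve -/

/-- The last point of the curve: the vertex of the cube that is adjacent to the origin along
axis `0`. -/
def endPoint (d : ℕ) : Fin d → ℝ := fun i => if (i : ℕ) = 0 then 1 else 0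

theorem endPoint_apply (i : Fin d) : endPoint d i = bval (decide ((i : ℕ) = 0)) := by
  simp [endPoint, bval]

theorem flip_bval (a b : Bool) : flip a (bval b) = bval (xor a b) := by
  cases a <;> cases b <;> simp [flip, bval]

theorem flip_zero (a : Bool) : flip a 0 = bval a := by
  cases a <;> simp [flip, bval]

theorem trans_app_zero (r : Fin (2 ^ d)) (i : Fin d) :
    (trans r).app 0 i = (bval (gray d r i) + bval (reflBit r i)) / 2 := by
  simp [trans_app, flip_zero]

theorem trans_app_endPoint (r : Fin (2 ^ d)) (i : Fin d) :
    (trans r).app (endPoint d) i =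
      (bval (gray d r i) + bval (xor (reflBit r i) (decide ((permFun r i : ℕ) = 0)))) / 2 := by
  simp [trans_app, endPoint_apply, flip_bval]

/-- The curve starts at the origin. -/
theorem trans_first_app_zero (r : Fin (2 ^ d)) (hr : (r : ℕ) = 0) : (trans r).app 0 = 0 := by
  ext i
  have h : reflBit r i = false := by
    have := reflection_val r i
    rw [reflection, if_pos hr, loc_val] at this
    cases hb : reflBit r i
    · rfl
    · simp [hb, gray, hr] at this
  simp [trans_app_zero, h, gray, hr, bval]

/-- The curve ends in `endPoint`. -/
theorem trans_last_app_endPoint (r : Fin (2 ^ d)) (hr : (r : ℕ) = 2 ^ d - 1) :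
    (trans r).app (endPoint d) = endPoint d := by
  ext i
  have hi := i.isLt
  rw [trans_app_endPoint, endPoint_apply]
  have hbit : ∀ p, (r : ℕ).testBit p = decide (p < d) := fun p => by
    rw [hr, Nat.testBit_two_pow_sub_one]
  have hg : gray d r i = decide ((i : ℕ) = 0) := by
    rw [gray, hbit, hbit, decide_eq_true (by omega : d - 1 - (i : ℕ) < d), Bool.true_xor,
      ← decide_not, decide_eq_decide]
    omega
  have ha : (permFun r i : ℕ) = 0 ↔ (i : ℕ) = d - 1 := by
    by_cases h : (i : ℕ) = d - 1
    · simp only [h, iff_true]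
      rw [permFun_last_eq_zero_iff r i h]
      intro p hp
      rw [hbit, hbit]; simp; omega
    · simp only [h, iff_false]
      rw [permFun_eq_zero_iff r i h, hbit, hbit]
      rintro ⟨h1, -⟩
      apply h1; simp; omega
  have h0 : (r : ℕ).testBit 0 = true := by rw [hbit]; simp; omega
  rw [reflBit, hg, h0]
  simp only [ha]
  by_cases h1 : (i : ℕ) = 0 <;> by_cases h2 : (i : ℕ) = d - 1 <;> simp [h1, h2, bval]

/-- Each subcube is entered where the preceding one is left. -/
theorem trans_succ_app_zero (r s : Fin (2 ^ d)) (hs : (s : ℕ) = r + 1) :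
    (trans r).app (endPoint d) = (trans s).app 0 := by
  ext i
  have hi := i.isLt
  rw [trans_app_endPoint, trans_app_zero]
  have hs0 : ¬ (s : ℕ) = 0 := by omega
  by_cases hl : (i : ℕ) = d - 1
  · have h1 : reflBit s i = !gray d s i := by
      have := reflection_val s i
      have h := loc_val s i
      rw [reflection, if_neg hs0, if_pos hl] at this
      generalize hc : loc s i = c at h this
      generalize gray d s i = b at h
      generalize reflBit s i = b' at this
      cases b <;> cases b' <;> (fin_cases c <;> simp_all)
    have h2 : xor (reflBit r i) (decide ((permFun r i : ℕ) = 0)) = !gray d r i := by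
      have : ¬ ((r : ℕ).testBit 0 = true ∧ (permFun r i : ℕ) = 0) := by
        rw [permFun_last_eq_zero_iff r i hl]
        rintro ⟨h1, h2⟩
        have : (r : ℕ) = 2 ^ d - 1 := by
          apply Nat.eq_of_testBit_eq
          intro p
          rw [Nat.testBit_two_pow_sub_one]
          by_cases hp : p < d
          · rw [h2 p hp, h1]; simp [hp]
          · rw [Nat.testBit_lt_two_pow (lt_of_lt_of_le r.isLt
              (Nat.pow_le_pow_right (by norm_num) (by omega)))]
            simp [hp]
        have := s.isLt
        omega
      rw [reflBit, decide_eq_true hl]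
      generalize (r : ℕ).testBit 0 = b at *
      cases b <;> by_cases h : (permFun r i : ℕ) = 0 <;> simp_all
    rw [h1, h2]
    cases gray d s i <;> cases gray d r i <;> simp [bval]
  · have h1 : reflBit s i = gray d r i := by
      have := reflection_val s i
      rw [reflection, if_neg hs0, if_neg hl, loc_val] at this
      simp only [hs, Nat.add_sub_cancel] at this
      cases h1 : gray d r i <;> cases h2 : reflBit s i <;> simp [h1, h2] at this ⊢
    have h2 : gray d s i = xor (gray d r i) (decide ((r : ℕ).testBit 0 = true ∧
        (permFun r i : ℕ) = 0)) := by
      have := gray_pred (r := s) (by omega) hi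
      rw [hs, Nat.add_sub_cancel] at this
      rw [this, hs, Bool.xor_assoc]
      conv_lhs => rw [← Bool.xor_false (gray d (r + 1) i)]
      congr 1
      rw [eq_comm, bne_eq_false_iff_eq, decide_eq_decide, permFun_eq_zero_iff r i hl]
      -- adding one turns a block of trailing ones into zeros and the zero before it into a one
      have hp : ∀ j, (r : ℕ).testBit j =
          xor (((r : ℕ) + 1).testBit j) (decide (∀ p < j, ((r : ℕ) + 1).testBit p = false)) :=
        fun j => by simpa using testBit_pred (r := (r : ℕ) + 1) (by omega) j
      have hz : ∀ j, (∀ p < j, ((r : ℕ) + 1).testBit p = false) ↔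
          ∀ p < j, (r : ℕ).testBit p = true := by
        intro j
        induction j with
        | zero => simp
        | succ j ih =>
          have e : ∀ q : ℕ → Prop, (∀ p < j + 1, q p) ↔ (∀ p < j, q p) ∧ q j := fun q =>
            ⟨fun h => ⟨fun p hp => h p (by omega), h j (by omega)⟩, fun h p hp => by
              rcases Nat.lt_succ_iff_lt_or_eq.mp hp with hp | rfl
              exacts [h.1 p hp, h.2]⟩
          rw [e, e, ih]
          refine and_congr_right fun h => ?_
          rw [hp j, decide_eq_true (ih.mpr h)]
          simp
      rw [hz]
      constructor
      · rintro ⟨h1, h2⟩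
        have h0 := h2 0 (by omega)
        refine ⟨h0, ?_, by rwa [h0]⟩
        rw [h0, hp, h1, decide_eq_true ((hz _).mpr h2)]; simp
      · rintro ⟨h0, h1, h2⟩
        rw [h0] at h1 h2
        refine ⟨?_, h2⟩
        have := hp (d - 1 - i)
        rw [decide_eq_true ((hz _).mpr h2)] at this
        rw [Bool.eq_false_of_not_eq_true h1] at this
        cases hb : ((r : ℕ) + 1).testBit (d - 1 - i)
        · simp [hb] at this
        · rfl
    have h3 : xor (reflBit r i) (decide ((permFun r i : ℕ) = 0)) = gray d s i := by
      rw [h2, reflBit, decide_eq_false hl]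
      generalize (r : ℕ).testBit 0 = b
      cases b <;> by_cases h : (permFun r i : ℕ) = 0 <;> simp [h]
    rw [h1, h3, add_comm]

/-! ### Faces of the cube -/

/-- Insert a binary digit into `ρ` at position `j`, namely the sum modulo two of `k` and the digit
that was at position `j` before. As that digit moves to position `j + 1`, the inserted digit of the
Gray code is `k`. -/
def insBit (j : ℕ) (k : Bool) (ρ : ℕ) : ℕ :=
  2 ^ j * (2 * (ρ / 2 ^ j) + (xor ((ρ / 2 ^ j).testBit 0) k).toNat) + ρ % 2 ^ j

theorem testBit_insBit (j : ℕ) (k : Bool) (ρ p : ℕ) : (insBit j k ρ).testBit p =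
    if p < j then ρ.testBit p else if p = j then xor (ρ.testBit j) k else ρ.testBit (p - 1) := by
  rw [insBit, Nat.testBit_two_pow_mul_add _ (Nat.mod_lt _ (by positivity))]
  split_ifs with h1 h2
  · rw [Nat.testBit_mod_two_pow]; simp [h1]
  · subst h2
    rw [Nat.sub_self, Nat.testBit_zero, Nat.testBit_div_two_pow, Nat.zero_add]
    cases xor (ρ.testBit p) k <;> simp
  · obtain ⟨q, rfl⟩ : ∃ q, p = j + 1 + q := ⟨p - (j + 1), by omega⟩
    rw [show j + 1 + q - j = q + 1 by omega, Nat.testBit_succ]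
    generalize xor ((ρ / 2 ^ j).testBit 0) k = b
    have : (2 * (ρ / 2 ^ j) + b.toNat) / 2 = ρ / 2 ^ j := by
      have := Bool.toNat_lt b; omega
    rw [this, Nat.testBit_div_two_pow]
    congr 1; omega

theorem insBit_lt {n j : ℕ} (hj : j ≤ n) (k : Bool) {ρ : ℕ} (h : ρ < 2 ^ n) :
    insBit j k ρ < 2 ^ (n + 1) := by
  apply Nat.lt_pow_two_of_testBit
  intro p hp
  have h0 : ∀ q, n ≤ q → ρ.testBit q = false := fun q hq =>
    Nat.testBit_lt_two_pow (lt_of_lt_of_le h (Nat.pow_le_pow_right (by norm_num) hq))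
  rw [testBit_insBit, if_neg (by omega), if_neg (by omega), h0 _ (by omega)]

theorem insBit_strictMono (j : ℕ) (k : Bool) : StrictMono (insBit j k) := by
  intro a b hab
  have ha := Nat.div_add_mod a (2 ^ j)
  have hb := Nat.div_add_mod b (2 ^ j)
  have hma := Nat.mod_lt a (show 0 < 2 ^ j by positivity)
  unfold insBit
  rcases (Nat.div_le_div_right hab.le : a / 2 ^ j ≤ b / 2 ^ j).lt_or_eq with h | h
  · generalize a / 2 ^ j = p at *
    generalize b / 2 ^ j = q at *
    have h1 : 2 * p + (xor (p.testBit 0) k).toNat + 1 ≤ 2 * q + (xor (q.testBit 0) k).toNat := by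
      have := Bool.toNat_lt (xor (p.testBit 0) k)
      omega
    have h2 := Nat.mul_le_mul_left (2 ^ j) h1
    rw [Nat.mul_add, Nat.mul_one] at h2
    omega
  · rw [h] at ha ⊢
    omega

variable {n : ℕ}

/-- The rank of the subcube of the `(n+1)`-dimensional cube that meets the face `x i = k` in the
same place as the subcube of rank `ρ` of the `n`-dimensional cube, mirrored in dimension `i` if `k`
is true. -/
def faceRank (i : Fin (n + 1)) (k : Bool) (ρ : Fin (2 ^ n)) : Fin (2 ^ (n + 1)) :=
  ⟨insBit (n - i) k ρ, insBit_lt (by omega) k ρ.isLt⟩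

theorem testBit_faceRank_succAbove (i : Fin (n + 1)) (k : Bool) (ρ : Fin (2 ^ n)) (j : Fin n) :
    (faceRank i k ρ : ℕ).testBit (n - i.succAbove j) = (ρ : ℕ).testBit (n - 1 - j) := by
  have hi := i.isLt
  have hj := j.isLt
  rw [faceRank]
  rcases lt_or_ge j.castSucc i with h | h
  · rw [Fin.succAbove_of_castSucc_lt _ _ h]
    rw [Fin.lt_def, Fin.val_castSucc] at h
    simp only [testBit_insBit, Fin.val_castSucc]
    rw [if_neg (by omega), if_neg (by omega)]
    congr 1; omega
  · rw [Fin.succAbove_of_le_castSucc _ _ h]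
    rw [Fin.le_def, Fin.val_castSucc] at h
    simp only [testBit_insBit, Fin.val_succ]
    rw [if_pos (by omega)]
    congr 1; omega

/-- The faces on which a lower-dimensional harmonious Hilbert curve can be seen: all but the back
face that is orthogonal to the last axis. -/
def Visible (i : Fin (n + 1)) (k : Bool) : Prop := k = true → (i : ℕ) ≠ n

theorem testBit_faceRank_zero {i : Fin (n + 1)} {k : Bool} (hik : Visible i k)
    (ρ : Fin (2 ^ n)) : (faceRank i k ρ : ℕ).testBit 0 = (ρ : ℕ).testBit 0 := by
  have hi := i.isLt
  simp only [faceRank, testBit_insBit]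
  split_ifs with h1 h2
  · rfl
  · have hk : k = false := by
      by_contra hc
      exact hik (by simpa using hc) (by omega)
    simp [hk, ← h2]
  · omega

theorem gray_faceRank_self (i : Fin (n + 1)) (k : Bool) (ρ : Fin (2 ^ n)) :
    gray (n + 1) (faceRank i k ρ) i = k := by
  have hi := i.isLt
  simp only [gray, faceRank, testBit_insBit]
  rw [if_neg (by omega), if_pos (by omega), if_neg (by omega), if_neg (by omega),
    show n + 1 - (i : ℕ) - 1 = n - i by omega]
  cases (ρ : ℕ).testBit (n - i) <;> simp

theorem gray_faceRank_succAbove (i : Fin (n + 1)) (k : Bool) (ρ : Fin (2 ^ n)) (j : Fin n) :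
    gray (n + 1) (faceRank i k ρ) (i.succAbove j) =
      xor (gray n ρ j) (k && decide ((j : ℕ) = i)) := by
  have hi := i.isLt
  have hj := j.isLt
  rw [gray, Nat.add_sub_cancel, testBit_faceRank_succAbove, gray, Bool.xor_assoc]
  congr 1
  rcases lt_or_ge j.castSucc i with h | h
  · rw [Fin.succAbove_of_castSucc_lt _ _ h]
    rw [Fin.lt_def, Fin.val_castSucc] at h
    simp only [faceRank, testBit_insBit, Fin.val_castSucc]
    rw [if_neg (by omega), if_neg (by omega), decide_eq_false (by omega)]
    simp
    congr 1; omega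
  · rw [Fin.succAbove_of_le_castSucc _ _ h]
    rw [Fin.le_def, Fin.val_castSucc] at h
    simp only [faceRank, testBit_insBit, Fin.val_succ]
    by_cases hij : (j : ℕ) = i
    · rw [if_neg (by omega), if_pos (by omega), hij]
      simp
    · rw [if_pos (by omega), decide_eq_false hij]
      simp

theorem differs_faceRank_succAbove {i : Fin (n + 1)} {k : Bool} (hik : Visible i k)
    (ρ : Fin (2 ^ n)) (j : Fin n) :
    differs (faceRank i k ρ) (i.succAbove j) ↔ differs ρ j := by
  rw [differs, Nat.add_sub_cancel, testBit_faceRank_succAbove, testBit_faceRank_zero hik, differs]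

theorem prec_faceRank_succAbove {i : Fin (n + 1)} {k : Bool} (hik : Visible i k)
    (ρ : Fin (2 ^ n)) (j l : Fin n) :
    prec (faceRank i k ρ) (i.succAbove j) (i.succAbove l) ↔ prec ρ j l := by
  rw [prec, differs_faceRank_succAbove hik, differs_faceRank_succAbove hik, prec,
    Fin.succAbove_lt_succAbove_iff]

/-- The permutation within a subcube that meets a face restricts to the permutation within the
corresponding lower-dimensional subcube. -/
theorem permFun_faceRank_succAbove {i : Fin (n + 1)} {k : Bool} (hik : Visible i k)
    (ρ : Fin (2 ^ n)) (j : Fin n) : permFun (faceRank i k ρ) (i.succAbove j) =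
      (permFun (faceRank i k ρ) i).succAbove (permFun ρ j) := by
  set r := faceRank i k ρ with hr
  have hcard : (permFun r (i.succAbove j) : ℕ) =
      (if prec r i (i.succAbove j) then 1 else 0) + permFun ρ j := by
    rw [permFun_val, permFun_val, Finset.card_filter, Fin.sum_univ_succAbove _ i,
      Finset.card_filter]
    simp only [hr, prec_faceRank_succAbove hik]
  by_cases hp : prec r i (i.succAbove j)
  · have h1 := (permFun_lt_iff r _ _).mpr hp
    rw [if_pos hp] at hcard
    rw [Fin.succAbove_of_le_castSucc (permFun r i)]
    · apply Fin.ext; rw [Fin.val_succ]; omega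
    · rw [Fin.lt_def] at h1
      rw [Fin.le_def, Fin.val_castSucc]; omega
  · have h1 : permFun r (i.succAbove j) < permFun r i := by
      refine lt_of_le_of_ne (not_lt.mp (mt (permFun_lt_iff r _ _).mp hp)) ?_
      exact fun h => Fin.succAbove_ne i j (permFun_injective r h)
    rw [if_neg hp] at hcard
    rw [Fin.succAbove_of_castSucc_lt (permFun r i)]
    · apply Fin.ext; rw [Fin.val_castSucc]; omega
    · rw [Fin.lt_def] at h1
      rw [Fin.lt_def, Fin.val_castSucc]; omega

/-- The axis of the face that the `(n+1)`-dimensional curve has within subcube `faceRank i k ρ`. -/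
def nextAxis (i : Fin (n + 1)) (k : Bool) (ρ : Fin (2 ^ n)) : Fin (n + 1) :=
  permFun (faceRank i k ρ) i

/-- The side of the face that the `(n+1)`-dimensional curve has within subcube `faceRank i k ρ`. -/
def nextSide (i : Fin (n + 1)) (k : Bool) (ρ : Fin (2 ^ n)) : Bool :=
  xor k (reflBit (faceRank i k ρ) i)

theorem nextSide_eq {i : Fin (n + 1)} {k : Bool} (hik : Visible i k)
    (ρ : Fin (2 ^ n)) : nextSide i k ρ = xor (decide ((i : ℕ) = n))
      (decide ((ρ : ℕ).testBit 0 = false ∧ (nextAxis i k ρ : ℕ) = 0)) := by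
  rw [nextSide, reflBit, gray_faceRank_self, testBit_faceRank_zero hik]
  simp [nextAxis]

/-- On the face orthogonal to the last axis, the last two axes of the cube have the same digit and
remain adjacent. -/
theorem permFun_eq_nextAxis_iff (hn : 1 ≤ n) {i : Fin (n + 1)} {k : Bool} (hik : Visible i k)
    (hi : (i : ℕ) = n) (ρ : Fin (2 ^ n)) (j : Fin n) :
    (permFun ρ j : ℕ) = nextAxis i k ρ ↔ (j : ℕ) = n - 1 := by
  have hlast : ∀ j : Fin n, (j : ℕ) = n - 1 → (permFun ρ j : ℕ) = nextAxis i k ρ := by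
    intro j hj
    have hdj : ¬ differs ρ j := by simp [differs, hj]
    have hdi : ¬ differs (faceRank i k ρ) i := by simp [differs, hi]
    rw [nextAxis, permFun_val, permFun_val, Finset.card_filter, Finset.card_filter,
      Fin.sum_univ_succAbove _ i, if_neg (by simp [prec]), zero_add]
    refine Finset.sum_congr rfl fun l _ => ?_
    have : prec ρ l j ↔ prec (faceRank i k ρ) (i.succAbove l) i := by
      have hl := l.isLt
      have h1 : ¬ i < i.succAbove l := by
        have := (i.succAbove l).isLt
        rw [Fin.lt_def]; omega
      have h2 : ¬ j < l := by rw [Fin.lt_def]; omega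
      simp [prec, differs_faceRank_succAbove hik, hdj, hdi, h1, h2]
    simp only [this]
  refine ⟨fun h => ?_, hlast j⟩
  have h' := hlast ⟨n - 1, by omega⟩ rfl
  have := permFun_injective ρ (Fin.ext (h.trans h'.symm))
  rw [this]

/-- The back face that is orthogonal to the last axis never shows up on a visible face. -/
theorem visible_next (hn : 1 ≤ n) {i : Fin (n + 1)} {k : Bool} (hik : Visible i k)
    (ρ : Fin (2 ^ n)) : Visible (nextAxis i k ρ) (nextSide i k ρ) := by
  intro h
  rw [nextSide_eq hik] at h
  by_cases hi : (i : ℕ) = n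
  · have := (permFun_eq_nextAxis_iff hn hik hi ρ ⟨n - 1, by omega⟩).mpr rfl
    rw [← this]
    exact (permFun ρ _).isLt.ne
  · rw [decide_eq_false hi, Bool.false_xor, decide_eq_true_iff] at h
    omega

/-- The reflections within a subcube that meets a face restrict to those within the corresponding
lower-dimensional subcube, up to the mirroring that comes with back faces. -/
theorem reflBit_faceRank_succAbove (hn : 1 ≤ n) {i : Fin (n + 1)} {k : Bool} (hik : Visible i k)
    (ρ : Fin (2 ^ n)) (j : Fin n) :
    xor (reflBit (faceRank i k ρ) (i.succAbove j))
        (nextSide i k ρ && decide ((permFun ρ j : ℕ) = nextAxis i k ρ)) =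
      xor (k && decide ((j : ℕ) = i)) (reflBit ρ j) := by
  have hjl := j.isLt
  have hil := i.isLt
  rw [nextSide_eq hik, reflBit, gray_faceRank_succAbove, testBit_faceRank_zero hik, reflBit,
    permFun_faceRank_succAbove hik]
  change xor (xor _ (xor _ (decide (_ ∧ ((nextAxis i k ρ).succAbove (permFun ρ j) : ℕ) = 0)))) _ = _
  have hs : ((nextAxis i k ρ).succAbove (permFun ρ j) : ℕ) = 0 ↔
      ((nextAxis i k ρ : ℕ) ≠ 0 ∧ (permFun ρ j : ℕ) = 0) := by
    rcases lt_or_ge (permFun ρ j).castSucc (nextAxis i k ρ) with h | h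
    · rw [Fin.succAbove_of_castSucc_lt _ _ h]
      rw [Fin.lt_def, Fin.val_castSucc] at h
      rw [Fin.val_castSucc]; omega
    · rw [Fin.succAbove_of_le_castSucc _ _ h]
      rw [Fin.le_def, Fin.val_castSucc] at h
      rw [Fin.val_succ]; omega
  simp only [hs]
  have hlast : ((i.succAbove j : Fin (n + 1)) : ℕ) = n + 1 - 1 ↔ ((j : ℕ) = n - 1 ∧ (i : ℕ) ≠ n) := by
    rcases lt_or_ge j.castSucc i with h | h
    · rw [Fin.succAbove_of_castSucc_lt _ _ h]
      rw [Fin.lt_def, Fin.val_castSucc] at h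
      rw [Fin.val_castSucc]; omega
    · rw [Fin.succAbove_of_le_castSucc _ _ h]
      rw [Fin.le_def, Fin.val_castSucc] at h
      rw [Fin.val_succ]; omega
  simp only [hlast]
  -- only on the face orthogonal to the last axis does the last axis of the lower-dimensional cube
  -- differ from that of the higher-dimensional cube, and there it is the axis that may be mirrored
  by_cases hi : (i : ℕ) = n
  · simp only [permFun_eq_nextAxis_iff hn hik hi]
    have hj := permFun_eq_nextAxis_iff hn hik hi ρ j
    have hk : k = false := by
      by_contra hc
      exact hik (by simpa using hc) hi
    subst hk
    by_cases h1 : (ρ : ℕ).testBit 0 = false <;> by_cases h2 : (nextAxis i false ρ : ℕ) = 0 <;>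
      by_cases h3 : (j : ℕ) = n - 1 <;> by_cases h4 : (permFun ρ j : ℕ) = 0 <;>
      simp [hi, h1, h2, h3, h4] <;> simp_all
  · generalize gray n ρ j = b
    by_cases h1 : (ρ : ℕ).testBit 0 = false <;> by_cases h2 : (nextAxis i k ρ : ℕ) = 0 <;>
      by_cases h3 : (j : ℕ) = n - 1 <;> by_cases h4 : (permFun ρ j : ℕ) = 0 <;>
      by_cases h5 : (j : ℕ) = i <;>
      simp [hi, h1, h2, h3, h4, h5] <;> cases b <;> cases k <;> simp

/-- The embedding of the `n`-dimensional cube into the face `x i = k` of the `(n+1)`-dimensional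
cube. On a back face, the `n`-dimensional cube is first mirrored in dimension `i`. -/
noncomputable def faceEmb (i : Fin (n + 1)) (k : Bool) (y : Fin n → ℝ) : Fin (n + 1) → ℝ :=
  i.insertNth (bval k) fun j => flip (k && decide ((j : ℕ) = i)) (y j)

/-- On each visible face, the recursion of the `(n+1)`-dimensional curve induces the recursion of the
`n`-dimensional curve. -/
theorem trans_faceRank (hn : 1 ≤ n) {i : Fin (n + 1)} {k : Bool} (hik : Visible i k)
    (ρ : Fin (2 ^ n)) (y : Fin n → ℝ) :
    (trans (faceRank i k ρ)).app (faceEmb (nextAxis i k ρ) (nextSide i k ρ) y) =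
      faceEmb i k ((trans ρ).app y) := by
  ext l
  rw [trans_app]
  refine Fin.succAboveCases i ?_ (fun j => ?_) l
  · have : faceEmb (nextAxis i k ρ) (nextSide i k ρ) y (permFun (faceRank i k ρ) i) =
        bval (nextSide i k ρ) := by
      change faceEmb (nextAxis i k ρ) _ _ (nextAxis i k ρ) = _
      simp [faceEmb]
    rw [this, gray_faceRank_self, flip_bval, nextSide, faceEmb, Fin.insertNth_apply_same]
    cases k <;> cases reflBit (faceRank i _ ρ) i <;> simp [bval]
  · rw [permFun_faceRank_succAbove hik]
    change (_ + flip _ (faceEmb (nextAxis i k ρ) _ _ ((nextAxis i k ρ).succAbove _))) / 2 = _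
    rw [faceEmb, faceEmb, Fin.insertNth_apply_succAbove, Fin.insertNth_apply_succAbove, ← flip_xor,
      reflBit_faceRank_succAbove hn hik, gray_faceRank_succAbove, trans_app, flip_xor]
    cases (k && decide ((j : ℕ) = i)) <;> cases gray n ρ j <;> simp [bval, flip] <;> ring

end Harmonious

/-! ### Averaging over a finite group -/

section Averaging

open scoped Pointwise

variable {G ι : Type*} [Group G] [Fintype ι] [Nonempty ι] {w : ι → G} {h : ℕ → G → ℝ}

theorem average_le (hstep : ∀ l g, h (l + 1) g = (∑ r, h l ((w r)⁻¹ * g)) / Fintype.card ι)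
    {l : ℕ} {b : ℝ} (hb : ∀ x, h l x ≤ b) (m : ℕ) (x : G) : h (l + m) x ≤ b := by
  have hN : (0 : ℝ) < Fintype.card ι := by exact_mod_cast Fintype.card_pos
  induction m generalizing x with
  | zero => exact hb x
  | succ m ih =>
    rw [← add_assoc, hstep, div_le_iff₀ hN]
    calc ∑ r, h (l + m) ((w r)⁻¹ * x) ≤ ∑ _r : ι, b := Finset.sum_le_sum fun r _ => ih _
      _ = b * Fintype.card ι := by simp [mul_comm]

/-- After averaging `m` times, the value at a point is pulled towards the original value at every
point from which it can be reached in `m` steps. -/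
theorem average_le_sub (hstep : ∀ l g, h (l + 1) g = (∑ r, h l ((w r)⁻¹ * g)) / Fintype.card ι)
    {l : ℕ} {b : ℝ} (hb : ∀ x, h l x ≤ b) (m : ℕ) {g : G} (hg : g ∈ Set.range w ^ m) (x : G) :
    h (l + m) (g * x) ≤ b - (1 / (Fintype.card ι : ℝ)) ^ m * (b - h l x) := by
  classical
  have hN : (0 : ℝ) < Fintype.card ι := by exact_mod_cast Fintype.card_pos
  induction m generalizing g with
  | zero =>
    rw [pow_zero, Set.mem_one] at hg
    subst hg
    simp
  | succ m ih =>
    rw [pow_succ'] at hg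
    obtain ⟨_, ⟨r, rfl⟩, g', hg', rfl⟩ := Set.mem_mul.mp hg
    have h1 := ih hg'
    rw [← add_assoc, hstep, div_le_iff₀ hN, ← Finset.add_sum_erase _ _ (Finset.mem_univ r)]
    have h2 : ∑ s ∈ Finset.univ.erase r, h (l + m) ((w s)⁻¹ * (w r * g' * x)) ≤
        ∑ _s ∈ Finset.univ.erase r, b := Finset.sum_le_sum fun s _ => average_le hstep hb m _
    rw [Finset.sum_const, Finset.card_erase_of_mem (Finset.mem_univ _), Finset.card_univ,
      nsmul_eq_mul, Nat.cast_sub Fintype.card_pos] at h2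
    have h3 : (w r)⁻¹ * (w r * g' * x) = g' * x := by group
    rw [h3, pow_succ]
    have h4 : (b - (1 / (Fintype.card ι : ℝ)) ^ m * (1 / (Fintype.card ι : ℝ)) * (b - h l x)) *
        Fintype.card ι = b * Fintype.card ι - (1 / (Fintype.card ι : ℝ)) ^ m * (b - h l x) := by
      field_simp
    rw [h4]
    push_cast at h2
    linarith

/-- Repeated averaging over the translates by the elements of a family converges to the mean,
provided that, for some `m`, each element of the group is a product of `m` members of the family. -/
theorem tendsto_average [Fintype G]
    (hstep : ∀ l g, h (l + 1) g = (∑ r, h l ((w r)⁻¹ * g)) / Fintype.card ι)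
    {m : ℕ} (hm : Set.range w ^ m = Set.univ) (g : G) :
    Tendsto (fun l => h l g) atTop (𝓝 ((∑ x, h 0 x) / Fintype.card G)) := by
  have hN : (0 : ℝ) < Fintype.card ι := by exact_mod_cast Fintype.card_pos
  have hN1 : (1 : ℝ) ≤ Fintype.card ι := by exact_mod_cast (Fintype.card_pos : 0 < Fintype.card ι)
  have hG : (0 : ℝ) < Fintype.card G := by exact_mod_cast Fintype.card_pos
  have hneg : ∀ l g, (-h) (l + 1) g = (∑ r, (-h) l ((w r)⁻¹ * g)) / Fintype.card ι := by
    intro l g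
    simp [hstep, Finset.sum_neg_distrib, neg_div]
  have hge : ∀ {l : ℕ} {a : ℝ}, (∀ x, a ≤ h l x) → ∀ m x, a ≤ h (l + m) x := fun ha m x => by
    have := average_le hneg (b := -_) (fun x => neg_le_neg (ha x)) m x
    exact neg_le_neg_iff.mp this
  set ε : ℝ := (1 / (Fintype.card ι : ℝ)) ^ m with hε
  have hε0 : 0 < ε := by positivity
  have hε1 : ε ≤ 1 := pow_le_one₀ (by positivity) (by rw [div_le_one hN]; exact hN1)
  -- averaging preserves the sum
  have hsum : ∀ l, ∑ x, h l x = ∑ x, h 0 x := by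
    intro l
    induction l with
    | zero => rfl
    | succ l ih =>
      simp only [hstep]
      rw [← Finset.sum_div, Finset.sum_comm]
      have : ∀ r, ∑ x, h l ((w r)⁻¹ * x) = ∑ x, h l x := fun r =>
        Equiv.sum_comp (Equiv.mulLeft (w r)⁻¹) (h l)
      simp only [this, ih, Finset.sum_const, Finset.card_univ, nsmul_eq_mul]
      field_simp
  -- every `m` steps, the range of values shrinks by a constant factor
  have hosc : ∃ C : ℝ, ∀ j : ℕ, ∃ a b : ℝ, (∀ x, a ≤ h (j * m) x) ∧ (∀ x, h (j * m) x ≤ b) ∧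
      b - a ≤ (1 - ε) ^ j * C := by
    obtain ⟨b, hb⟩ := (Set.finite_range (h 0)).bddAbove
    obtain ⟨a, ha⟩ := (Set.finite_range (h 0)).bddBelow
    refine ⟨b - a, fun j => ?_⟩
    induction j with
    | zero =>
      refine ⟨a, b, ?_, ?_, by simp⟩
      · intro x; rw [zero_mul]; exact ha ⟨x, rfl⟩
      · intro x; rw [zero_mul]; exact hb ⟨x, rfl⟩
    | succ j ih =>
      obtain ⟨a', b', ha', hb', hab⟩ := ih
      have hmem : ∀ x : G, x ∈ Set.range w ^ m := fun x => hm ▸ Set.mem_univ x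
      refine ⟨a' + ε * (h (j * m) 1 - a'), b' - ε * (b' - h (j * m) 1), fun x => ?_, fun x => ?_, ?_⟩
      · have := average_le_sub hneg (b := -a') (fun x => neg_le_neg (ha' x)) m (hmem x) 1
        rw [mul_one, ← hε] at this
        rw [Nat.succ_mul]
        simp only [Pi.neg_apply] at this
        linarith
      · have := average_le_sub hstep hb' m (hmem x) 1
        rwa [mul_one, ← Nat.succ_mul] at this
      · rw [pow_succ]
        have := mul_le_mul_of_nonneg_left hab (sub_nonneg.mpr hε1)
        linarith
  obtain ⟨C, hC⟩ := hosc
  rw [Metric.tendsto_atTop]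
  intro δ hδ
  have hlim : Tendsto (fun j : ℕ => (1 - ε) ^ j * C) atTop (𝓝 0) := by
    simpa using (tendsto_pow_atTop_nhds_zero_of_lt_one (sub_nonneg.mpr hε1)
      (by linarith : 1 - ε < 1)).mul_const C
  obtain ⟨j, hj⟩ := (hlim.eventually (gt_mem_nhds hδ)).exists
  obtain ⟨a, b, ha, hb, hab⟩ := hC j
  refine ⟨j * m, fun l hl => ?_⟩
  obtain ⟨q, rfl⟩ := Nat.exists_eq_add_of_le hl
  have h1 : ∀ x, a ≤ h (j * m + q) x := hge ha q
  have h2 : ∀ x, h (j * m + q) x ≤ b := average_le hstep hb q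
  have h3 : a ≤ (∑ x, h 0 x) / Fintype.card G := by
    rw [le_div_iff₀ hG, ← hsum (j * m + q)]
    calc a * Fintype.card G = ∑ _x : G, a := by simp [mul_comm]
      _ ≤ _ := Finset.sum_le_sum fun x _ => h1 x
  have h4 : (∑ x, h 0 x) / Fintype.card G ≤ b := by
    rw [div_le_iff₀ hG, ← hsum (j * m + q)]
    calc _ ≤ ∑ _x : G, b := Finset.sum_le_sum fun x _ => h2 x
      _ = b * Fintype.card G := by simp [mul_comm]
  rw [Real.dist_eq, abs_lt]
  have := h1 g
  have := h2 g
  constructor <;> linarith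

/-- In a finite group, if the products of two members of a set include the identity and a set of
generators, then, for some `m`, each element is a product of `m` members. -/
theorem exists_pow_eq_univ [Fintype G] {K : Set G} (h1 : (1 : G) ∈ K * K) {S : Set G} (hS : S ⊆ K * K)
    (hgen : Subgroup.closure S = ⊤) : ∃ m : ℕ, K ^ m = Set.univ := by
  have hmem : ∀ g : G, ∃ m : ℕ, g ∈ (K * K) ^ m := by
    intro g
    have hg : g ∈ Submonoid.closure (K * K) := by
      have : g ∈ (Subgroup.closure S).toSubmonoid := by rw [hgen]; trivial
      rw [Subgroup.closure_toSubmonoid_of_finite] at this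
      exact Submonoid.closure_mono hS this
    induction hg using Submonoid.closure_induction with
    | mem x hx => exact ⟨1, by simpa using hx⟩
    | one => exact ⟨0, by simp⟩
    | mul x y _ _ hx hy =>
      obtain ⟨m, hm⟩ := hx
      obtain ⟨k, hk⟩ := hy
      exact ⟨m + k, by rw [pow_add]; exact Set.mul_mem_mul hm hk⟩
  choose m hm using hmem
  refine ⟨2 * Finset.univ.sup m, Set.eq_univ_of_forall fun g => ?_⟩
  rw [pow_mul, pow_two]
  exact Set.pow_subset_pow_right h1 (Finset.le_sup (Finset.mem_univ g)) (hm g)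

end Averaging

namespace Harmonious

/-! ### The permutations generate the symmetric group -/

open scoped Pointwise

variable {d n : ℕ}

/-- As `perm r` lists the axes in the order `prec r`, it is the only monotone permutation for this
order. -/
theorem perm_eq_of_prec {d : ℕ} {r : Fin (2 ^ d)} {e : Equiv.Perm (Fin d)}
    (h : ∀ i j, prec r i j → e i < e j) : perm r = e := by
  have h1 : StrictMono (e ∘ (perm r).symm) := fun a b hab => h _ _ <| by
    rw [← permFun_lt_iff]
    change perm r _ < perm r _
    simpa using hab
  have h2 : e ∘ (perm r).symm = id := (StrictMono.range_inj h1 strictMono_id).mp (by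
    rw [Set.range_id, (e.surjective.comp (perm r).symm.surjective).range_eq])
  ext i
  have := congrFun h2 (perm r i)
  simp at this
  rw [this]

theorem perm_zero (r : Fin (2 ^ (n + 2))) (hr : (r : ℕ) = 0) : perm r = Fin.revPerm := by
  refine perm_eq_of_prec fun i j h => ?_
  simp only [prec, differs, hr] at h
  simp at h
  simpa using h

theorem perm_one_mul_perm_zero (r s : Fin (2 ^ (n + 2))) (hr : (r : ℕ) = 1) (hs : (s : ℕ) = 0) :
    perm r * perm s = (finRotate (n + 2))⁻¹ := by
  have hrot : ∀ k : Fin (n + 2), (((finRotate (n + 2))⁻¹ k : Fin (n + 2)) : ℕ) =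
      if (k : ℕ) = 0 then n + 1 else k - 1 := by
    intro k
    obtain ⟨y, rfl⟩ := (finRotate (n + 2)).surjective k
    rw [Equiv.Perm.inv_def, Equiv.symm_apply_apply, coe_finRotate]
    by_cases hy : y = Fin.last (n + 1)
    · simp [hy]
    · simp [hy]
  have hinv : (Fin.revPerm : Equiv.Perm (Fin (n + 2)))⁻¹ = Fin.revPerm := rfl
  rw [perm_zero s hs]
  apply mul_eq_of_eq_mul_inv
  rw [hinv]
  refine perm_eq_of_prec fun i j h => ?_
  have hd : ∀ i : Fin (n + 2), differs r i ↔ (i : ℕ) ≠ n + 1 := by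
    intro i
    have := i.isLt
    rw [differs, hr, Nat.testBit_one_eq_true_iff_self_eq_zero.mpr rfl, ne_eq,
      Nat.testBit_one_eq_true_iff_self_eq_zero]
    omega
  simp only [prec, hd, Fin.lt_def] at h
  rw [Fin.lt_def, Equiv.Perm.mul_apply, Equiv.Perm.mul_apply, hrot, hrot, Fin.revPerm_apply,
    Fin.revPerm_apply, Fin.val_rev, Fin.val_rev]
  have := i.isLt
  have := j.isLt
  split_ifs <;> omega

theorem perm_two_mul_perm_zero (r s : Fin (2 ^ (n + 2))) (hr : (r : ℕ) = 2) (hs : (s : ℕ) = 0) :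
    perm r * perm s = Equiv.swap 1 0 := by
  have hswap : ∀ k : Fin (n + 2), ((Equiv.swap (1 : Fin (n + 2)) 0 k : Fin (n + 2)) : ℕ) =
      if (k : ℕ) = 1 then 0 else if (k : ℕ) = 0 then 1 else (k : ℕ) := by
    intro k
    rw [Equiv.swap_apply_def]
    simp only [Fin.ext_iff]
    split_ifs <;> simp_all
  have hinv : (Fin.revPerm : Equiv.Perm (Fin (n + 2)))⁻¹ = Fin.revPerm := rfl
  rw [perm_zero s hs]
  apply mul_eq_of_eq_mul_inv
  rw [hinv]
  refine perm_eq_of_prec fun i j h => ?_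
  have hd : ∀ i : Fin (n + 2), differs r i ↔ (i : ℕ) = n := by
    intro i
    have := i.isLt
    have h2 : ∀ p, Nat.testBit 2 p = decide (1 = p) := fun p => Nat.testBit_two_pow (n := 1)
    rw [differs, hr, h2, h2]
    simp
    omega
  simp only [prec, hd, Fin.lt_def] at h
  rw [Fin.lt_def, Equiv.Perm.mul_apply, Equiv.Perm.mul_apply, hswap, hswap, Fin.revPerm_apply,
    Fin.revPerm_apply, Fin.val_rev, Fin.val_rev]
  have := i.isLt
  have := j.isLt
  split_ifs <;> omega

/-- For some `m`, the permutations of the cells of depth `m` include all permutations. The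
permutations of rank zero, one and two suffice to obtain generators of the symmetric group: a cycle
of all axes and a transposition of neighbours. -/
theorem exists_range_perm_pow_eq_univ {d : ℕ} (hd : 1 ≤ d) :
    ∃ m : ℕ, Set.range (perm : Fin (2 ^ d) → Equiv.Perm (Fin d)) ^ m = Set.univ := by
  obtain rfl | ⟨n, rfl⟩ : d = 1 ∨ ∃ n, d = n + 2 := by
    rcases Nat.lt_or_ge d 2 with h | h
    · exact Or.inl (by omega)
    · exact Or.inr ⟨d - 2, by omega⟩
  · refine ⟨1, ?_⟩
    rw [pow_one, Set.range_eq_univ]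
    exact fun g => ⟨0, Subsingleton.elim _ _⟩
  · have h4 : 4 ≤ 2 ^ (n + 2) := by
      rw [pow_add]
      have := Nat.one_le_two_pow (n := n)
      omega
    let r : (k : ℕ) → k < 4 → Fin (2 ^ (n + 2)) := fun k hk => ⟨k, by omega⟩
    apply exists_pow_eq_univ (S := {(finRotate (n + 2))⁻¹, Equiv.swap 1 ((finRotate (n + 2))⁻¹ 1)})
    · refine Set.mem_mul.mpr ⟨_, ⟨r 0 (by omega), rfl⟩, _, ⟨r 0 (by omega), rfl⟩, ?_⟩
      rw [perm_zero _ rfl]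
      ext i
      simp
    · have h1 : (finRotate (n + 2))⁻¹ 1 = 0 := by
        rw [Equiv.Perm.inv_eq_iff_eq]
        ext
        simp
      rw [h1]
      rintro g (rfl | rfl)
      · exact Set.mem_mul.mpr ⟨_, ⟨r 1 (by omega), rfl⟩, _, ⟨r 0 (by omega), rfl⟩,
          perm_one_mul_perm_zero _ _ rfl rfl⟩
      · exact Set.mem_mul.mpr ⟨_, ⟨r 2 (by omega), rfl⟩, _, ⟨r 0 (by omega), rfl⟩,
          perm_two_mul_perm_zero _ _ rfl rfl⟩
    · exact Equiv.Perm.closure_cycle_adjacent_swap isCycle_finRotate.inv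
        (by rw [Equiv.Perm.support_inv, support_finRotate]) 1

/-! ### Subcubes -/

theorem gray_injective {r s : ℕ} (hr : r < 2 ^ d) (hs : s < 2 ^ d)
    (h : ∀ i < d, gray d r i = gray d s i) : r = s := by
  have h0 : ∀ {r}, r < 2 ^ d → ∀ q, d ≤ q → r.testBit q = false := fun hr q hq =>
    Nat.testBit_lt_two_pow (lt_of_lt_of_le hr (Nat.pow_le_pow_right (by norm_num) hq))
  have key : ∀ m ≤ d, r.testBit (d - m) = s.testBit (d - m) := by
    intro m
    induction m with
    | zero => intro _; rw [h0 hr _ (by omega), h0 hs _ (by omega)]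
    | succ m ih =>
      intro hm
      have h1 := ih (by omega)
      have h2 := h m (by omega)
      rw [gray, gray, h1, show d - 1 - m = d - (m + 1) by omega] at h2
      exact Bool.xor_left_inj.mp h2
  apply Nat.eq_of_testBit_eq
  intro p
  by_cases hp : p < d
  · simpa [show d - (d - p) = p by omega] using key (d - p) (by omega)
  · rw [h0 hr _ (by omega), h0 hs _ (by omega)]

theorem loc_bijective : Function.Bijective (loc : Fin (2 ^ d) → Fin d → Fin 2) := by
  rw [Fintype.bijective_iff_injective_and_card]
  refine ⟨fun r s h => Fin.ext (gray_injective r.isLt s.isLt fun i hi => ?_), by simp⟩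
  have h1 := loc_val r ⟨i, hi⟩
  have h2 := loc_val s ⟨i, hi⟩
  rw [h, h2] at h1
  cases h3 : gray d r i <;> cases h4 : gray d s i <;> simp [h3, h4] at h1 ⊢

theorem flip_mem {b : Bool} {x : ℝ} (h0 : 0 ≤ x) (h1 : x ≤ 1) : 0 ≤ flip b x ∧ flip b x ≤ 1 := by
  cases b <;> simp [flip, h0, h1]

theorem mem_unitCube {x : Fin d → ℝ} : x ∈ unitCube d ↔ ∀ i, 0 ≤ x i ∧ x i ≤ 1 := by
  rw [unitCube, Set.mem_Icc, Pi.le_def, Pi.le_def, ← forall_and]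
  rfl

theorem image_trans (r : Fin (2 ^ d)) :
    (trans r).app '' unitCube d = gridCell 2 (loc r) := by
  have hloc : ∀ i, ((loc r i : ℕ) : ℝ) = bval (gray d r i) := fun i => by
    rw [loc_val]; cases gray d r i <;> simp [bval]
  ext x
  simp only [gridCell, Set.mem_image, Set.mem_ofPred_eq, hloc]
  constructor
  · rintro ⟨p, hp, rfl⟩ i
    have := flip_mem (b := reflBit r i) (mem_unitCube.mp hp (permFun r i)).1
      (mem_unitCube.mp hp (permFun r i)).2
    rw [trans_app]
    push_cast
    constructor <;> linarith
  · intro h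
    refine ⟨fun a => flip (reflBit r ((perm r).symm a))
      (2 * x ((perm r).symm a) - bval (gray d r ((perm r).symm a))), mem_unitCube.mpr fun a => ?_, ?_⟩
    · have := h ((perm r).symm a)
      push_cast at this
      apply flip_mem <;> linarith [this.1, this.2]
    · ext i
      have : (perm r).symm (permFun r i) = i := (perm r).symm_apply_apply i
      rw [trans_app, this, ← flip_xor]
      simp [flip]

theorem isRegular (d : ℕ) : (harmoniousOrder d).IsRegular 2 := fun _ =>
  ⟨rfl, Equiv.ofBijective loc loc_bijective, fun r => image_trans r⟩

theorem trans_mem_unitCube (r : Fin (2 ^ d)) {x : Fin d → ℝ} (hx : x ∈ unitCube d) :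
    (trans r).app x ∈ unitCube d := by
  rw [mem_unitCube] at hx ⊢
  intro i
  have := flip_mem (b := reflBit r i) (hx (permFun r i)).1 (hx (permFun r i)).2
  rw [trans_app]
  cases gray d r i <;> simp [bval] <;> constructor <;> linarith

theorem exists_trans_eq {x : Fin d → ℝ} (hx : x ∈ unitCube d) :
    ∃ r : Fin (2 ^ d), ∃ y ∈ unitCube d, (trans r).app y = x := by
  obtain ⟨r, hr⟩ := loc_bijective.surjective fun i => if x i ≤ 1 / 2 then 0 else 1
  refine ⟨r, ?_⟩
  change x ∈ (trans r).app '' unitCube d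
  rw [image_trans, hr]
  intro i
  have := mem_unitCube.mp hx i
  dsimp only
  by_cases h : x i ≤ 1 / 2
  · rw [if_pos h]
    norm_num
    constructor <;> linarith
  · rw [if_neg h]
    norm_num
    constructor <;> linarith

theorem dist_trans_le (r : Fin (2 ^ d)) (x y : Fin d → ℝ) :
    dist ((trans r).app x) ((trans r).app y) ≤ 1 / 2 * dist x y := by
  rw [dist_pi_le_iff (by positivity)]
  intro i
  have h := dist_le_pi_dist x y (permFun r i)
  have h2 : (trans r).app x i - (trans r).app y i =
      1 / 2 * (flip (reflBit r i) (x (permFun r i)) - flip (reflBit r i) (y (permFun r i))) := by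
    rw [trans_app, trans_app]; ring
  rw [Real.dist_eq] at h ⊢
  rw [h2, abs_mul, abs_of_pos (by norm_num : (0 : ℝ) < 1 / 2)]
  refine mul_le_mul_of_nonneg_left (le_trans (le_of_eq ?_) h) (by norm_num)
  cases reflBit r i
  · rfl
  · simp only [flip, if_true]; rw [abs_sub_comm]; congr 1; ring

/-! ### Cells at all depths of recursion -/

/-- The last base-`2 ^ d` digit of `k`, as the rank of a subcube. -/
def lastRank (d k : ℕ) : Fin (2 ^ d) := ⟨k % 2 ^ d, Nat.mod_lt _ (by positivity)⟩

theorem mul_add_div_two_pow (q : ℕ) (r : Fin (2 ^ d)) : (q * 2 ^ d + r) / 2 ^ d = q := by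
  rw [mul_comm, Nat.mul_add_div (by positivity), Nat.div_eq_of_lt r.isLt, add_zero]

theorem lastRank_mul_add (q : ℕ) (r : Fin (2 ^ d)) : lastRank d (q * 2 ^ d + r) = r := by
  apply Fin.ext
  change (q * 2 ^ d + r) % 2 ^ d = r
  rw [mul_comm, Nat.mul_add_mod, Nat.mod_eq_of_lt r.isLt]

/-- The transformation of cell number `k` of depth `l` within a copy of the curve with
transformation `B`. -/
noncomputable def cellMap (B : Similarity d) : ℕ → ℕ → Similarity d
  | 0, _ => B
  | l + 1, k => (cellMap B l (k / 2 ^ d)).comp (trans (lastRank d k))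

theorem cellMap_succ_app (B : Similarity d) (l k : ℕ) (x : Fin d → ℝ) :
    (cellMap B (l + 1) k).app x = (cellMap B l (k / 2 ^ d)).app ((trans (lastRank d k)).app x) :=
  Similarity.app_comp _ _ _

/-- A piece of the harmonious Hilbert scanning order without reversal. -/
def mkPiece (B : Similarity d) : (harmoniousOrder d).Piece := ⟨(), B, false⟩

theorem range_mul_eq_flatMap (a b : ℕ) :
    List.range (a * b) = (List.range a).flatMap fun q => (List.range b).map (q * b + ·) := by
  induction a with
  | zero => simp
  | succ a ih =>
    rw [Nat.succ_mul, List.range_add, ih, List.range_succ, List.flatMap_append]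
    simp

theorem refineN_mkPiece (B : Similarity d) (l : ℕ) : (mkPiece B).refineN l =
    (List.range ((2 ^ d) ^ l)).map fun k => mkPiece (cellMap B l k) := by
  induction l with
  | zero => simp [ScanningOrder.Piece.refineN, cellMap]
  | succ l ih =>
    rw [ScanningOrder.Piece.refineN, ih, pow_succ, range_mul_eq_flatMap, List.map_flatMap,
      List.flatMap_map]
    congr 1
    ext1 q
    rw [List.map_map]
    have h1 : (mkPiece (cellMap B l q)).refine = (List.finRange (2 ^ d)).map fun r =>
        mkPiece ((cellMap B l q).comp (trans r)) := rfl
    rw [h1, ← List.map_coe_finRange_eq_range, List.map_map]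
    refine List.map_congr_left fun r _ => ?_
    simp [cellMap, mul_add_div_two_pow, lastRank_mul_add]

theorem pieces_eq (d l : ℕ) : (harmoniousOrder d).pieces l =
    (List.range ((2 ^ d) ^ l)).map fun k => mkPiece (cellMap (Similarity.refl d) l k) :=
  refineN_mkPiece _ l

theorem cellMap_first (B : Similarity d) (l : ℕ) : (cellMap B l 0).app 0 = B.app 0 := by
  induction l with
  | zero => rfl
  | succ l ih =>
    rw [cellMap_succ_app, trans_first_app_zero _ (by simp [lastRank]), Nat.zero_div, ih]

theorem pred_div_mod {N m : ℕ} (hN : 0 < N) (hm : 0 < m) :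
    (m * N - 1) / N = m - 1 ∧ (m * N - 1) % N = N - 1 := by
  obtain ⟨m, rfl⟩ := Nat.exists_eq_succ_of_ne_zero hm.ne'
  have : (m + 1) * N - 1 = (N - 1) + N * m := by
    rw [Nat.succ_mul, mul_comm]; omega
  rw [Nat.succ_eq_add_one, this, Nat.add_mul_div_left _ _ hN, Nat.add_mul_mod_self_left,
    Nat.div_eq_of_lt (by omega), Nat.mod_eq_of_lt (by omega)]
  omega

theorem cellMap_last (B : Similarity d) (l : ℕ) :
    (cellMap B l ((2 ^ d) ^ l - 1)).app (endPoint d) = B.app (endPoint d) := by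
  induction l with
  | zero => rfl
  | succ l ih =>
    have h := pred_div_mod (N := 2 ^ d) (m := (2 ^ d) ^ l) (by positivity) (by positivity)
    rw [cellMap_succ_app, pow_succ, h.1, trans_last_app_endPoint _ h.2, ih]

/-- Consecutive cells are connected: each cell is entered where the preceding one is left. -/
theorem cellMap_consecutive (B : Similarity d) (l k : ℕ) (hk : k + 1 < (2 ^ d) ^ l) :
    (cellMap B l k).app (endPoint d) = (cellMap B l (k + 1)).app 0 := by
  induction l generalizing k with
  | zero => simp at hk
  | succ l ih =>
    have hN : 0 < 2 ^ d := by positivity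
    rw [cellMap_succ_app, cellMap_succ_app]
    by_cases h : (k + 1) % 2 ^ d = 0
    · obtain ⟨m, hm⟩ := Nat.dvd_of_mod_eq_zero h
      have hm0 : 0 < m := by
        rcases Nat.eq_zero_or_pos m with rfl | hm0
        · simp at hm
        · exact hm0
      have hk' : k = m * 2 ^ d - 1 := by rw [mul_comm]; omega
      have h1 := pred_div_mod (N := 2 ^ d) hN hm0
      rw [← hk'] at h1
      rw [trans_last_app_endPoint _ h1.2, trans_first_app_zero _ h, h1.1, hm,
        Nat.mul_div_cancel_left _ hN]
      have : m < (2 ^ d) ^ l := by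
        rw [hm, pow_succ, mul_comm] at hk
        exact lt_of_mul_lt_mul_right hk (Nat.zero_le _)
      have h2 := ih (m - 1) (by omega)
      rwa [Nat.sub_add_cancel hm0] at h2
    · have h1 : (k + 1) / 2 ^ d = k / 2 ^ d := by
        rw [Nat.succ_div, if_neg (fun hd => h (Nat.mod_eq_zero_of_dvd hd)), add_zero]
      have h2 : (k + 1) % 2 ^ d = k % 2 ^ d + 1 := by
        have e1 := Nat.div_add_mod (k + 1) (2 ^ d)
        have e2 := Nat.div_add_mod k (2 ^ d)
        rw [h1] at e1
        omega
      rw [h1, trans_succ_app_zero (lastRank d k) (lastRank d (k + 1)) h2]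

/-- The region occupied by cell number `k` of depth `l`. -/
def cell (d l k : ℕ) : Set (Fin d → ℝ) := (cellMap (Similarity.refl d) l k).app '' unitCube d

theorem zero_mem_unitCube : (0 : Fin d → ℝ) ∈ unitCube d := mem_unitCube.mpr (by simp)

theorem endPoint_mem_unitCube : endPoint d ∈ unitCube d := mem_unitCube.mpr fun i => by
  rw [endPoint]; split_ifs <;> simp

theorem isVertexContinuous (d : ℕ) : (harmoniousOrder d).IsVertexContinuous := by
  intro h l _
  rw [pieces_eq, List.isChain_map]
  have hpos : 0 < (2 ^ d) ^ l := by positivity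
  refine List.isChain_iff_getElem.mpr fun k hk => ?_
  rw [List.length_range] at hk
  rw [List.getElem_range, List.getElem_range]
  refine ⟨mkPiece (cellMap (cellMap (Similarity.refl d) h k) l ((2 ^ d) ^ l - 1)), ?_,
    mkPiece (cellMap (cellMap (Similarity.refl d) h (k + 1)) l 0), ?_,
    (cellMap (Similarity.refl d) h k).app (endPoint d), ?_, ?_⟩
  · rw [refineN_mkPiece, List.getLast?_map, List.getLast?_range, if_neg hpos.ne']
    rfl
  · rw [refineN_mkPiece, List.head?_map, List.head?_range, if_neg hpos.ne']
    rfl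
  · exact ⟨_, endPoint_mem_unitCube, cellMap_last _ _⟩
  · rw [cellMap_consecutive _ _ _ hk]
    exact ⟨_, zero_mem_unitCube, cellMap_first _ _⟩

/-! ### Neutral orientation -/

/-- The permutation of the axes within cell number `k` of depth `l`. -/
noncomputable def cellPerm (d : ℕ) : ℕ → ℕ → Equiv.Perm (Fin d)
  | 0, _ => 1
  | l + 1, k => perm (lastRank d k) * cellPerm d l (k / 2 ^ d)

theorem cellMap_rot_ne_zero_iff (l k : ℕ) (i j : Fin d) :
    ((cellMap (Similarity.refl d) l k).rot : Matrix (Fin d) (Fin d) ℝ) i j ≠ 0 ↔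
      j = cellPerm d l k i := by
  induction l generalizing k i j with
  | zero =>
    change (1 : Matrix (Fin d) (Fin d) ℝ) i j ≠ 0 ↔ j = i
    rw [Matrix.one_apply]
    split_ifs with h <;> simp [h, eq_comm]
  | succ l ih =>
    set M := ((cellMap (Similarity.refl d) l (k / 2 ^ d)).rot : Matrix (Fin d) (Fin d) ℝ) with hM
    set e := cellPerm d l (k / 2 ^ d) with he
    have h1 : ((cellMap (Similarity.refl d) (l + 1) k).rot : Matrix (Fin d) (Fin d) ℝ) i j =
        M i (e i) * matrix (lastRank d k) (e i) j := by
      change (M * matrix (lastRank d k)) i j = _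
      rw [Matrix.mul_apply, Finset.sum_eq_single (e i)]
      · intro b _ hb
        have := (not_iff_not.mpr (ih (k / 2 ^ d) i b)).mpr hb
        rw [not_not] at this
        exact mul_eq_zero_of_left this _
      · simp
    have h2 : M i (e i) ≠ 0 := (ih _ _ _).mpr rfl
    have h3 : matrix (lastRank d k) (e i) j ≠ 0 ↔ j = perm (lastRank d k) (e i) := by
      unfold matrix
      by_cases h : j = perm (lastRank d k) (e i)
      · simp only [h, if_true, iff_true]
        split_ifs <;> norm_num
      · simp [h]
    rw [h1, mul_ne_zero_iff, and_iff_right h2, h3]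
    rfl

theorem hasRotation_iff (l k : ℕ) (π : Equiv.Perm (Fin d)) :
    ScanningOrder.HasRotation π (mkPiece (cellMap (Similarity.refl d) l k)) ↔
      cellPerm d l k = π := by
  constructor
  · intro h
    ext1 i
    exact ((h i _).mp ((cellMap_rot_ne_zero_iff l k i _).mpr rfl))
  · rintro rfl i j
    exact cellMap_rot_ne_zero_iff l k i j

theorem sum_range_mul {M : Type*} [AddCommMonoid M] (f : ℕ → M) (a b : ℕ) :
    ∑ k ∈ Finset.range (a * b), f k =
      ∑ q ∈ Finset.range a, ∑ r ∈ Finset.range b, f (q * b + r) := by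
  induction a with
  | zero => simp
  | succ a ih => rw [Nat.succ_mul, Finset.sum_range_add, ih, Finset.sum_range_succ]

/-- The fraction of the cells of depth `l` that have their axes permuted according to `g`. -/
noncomputable def permFreq (d l : ℕ) (g : Equiv.Perm (Fin d)) : ℝ :=
  (∑ k ∈ Finset.range ((2 ^ d) ^ l), if cellPerm d l k = g then (1 : ℝ) else 0) / ((2 ^ d) ^ l : ℕ)

theorem permFreq_succ (l : ℕ) (g : Equiv.Perm (Fin d)) : permFreq d (l + 1) g =
    (∑ r, permFreq d l ((perm r)⁻¹ * g)) / Fintype.card (Fin (2 ^ d)) := by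
  unfold permFreq
  rw [← Finset.sum_div, pow_succ, sum_range_mul, Finset.sum_comm, ← Fin.sum_univ_eq_sum_range
    (fun r => ∑ q ∈ Finset.range ((2 ^ d) ^ l),
      if cellPerm d (l + 1) (q * 2 ^ d + r) = g then (1 : ℝ) else 0), Fintype.card_fin, div_div]
  congr 1
  · refine Finset.sum_congr rfl fun r _ => Finset.sum_congr rfl fun q _ => ?_
    rw [cellPerm, mul_add_div_two_pow, lastRank_mul_add]
    simp only [eq_inv_mul_iff_mul_eq]
  · push_cast; rfl

theorem hasNeutralOrientation {d : ℕ} (hd : 1 ≤ d) :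
    (harmoniousOrder d).HasNeutralOrientation := by
  intro π
  obtain ⟨m, hm⟩ := exists_range_perm_pow_eq_univ hd
  have h := tendsto_average (h := permFreq d) permFreq_succ hm π
  have h0 : ∑ x, permFreq d 0 x = 1 := by
    rw [Finset.sum_eq_single 1]
    · simp [permFreq, cellPerm]
    · intro g _ hg
      simp [permFreq, cellPerm, hg.symm]
    · simp
  rw [h0, Fintype.card_perm, Fintype.card_fin] at h
  refine h.congr fun l => ?_
  rw [permFreq, pieces_eq, List.length_map, List.length_range, List.countP_map]
  congr 1
  rw [Finset.sum_boole]
  norm_cast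
  rw [List.countP_eq_length_filter, ← Multiset.coe_card]
  rw [Finset.card_def, Finset.filter_val]
  congr 1
  rw [Finset.range_val, Multiset.range, Multiset.filter_coe]
  simp only [Function.comp_def, hasRotation_iff]

/-! ### Subdivision of the unit interval -/

/-- The number of an interval of length `1 / N ^ l` within `[0,1]` that contains `t`. The number
`t = 1` belongs to the last interval. -/
noncomputable def idx (N l : ℕ) (t : ℝ) : ℕ := min ⌊t * (N : ℝ) ^ l⌋₊ (N ^ l - 1)

theorem idx_lt {N : ℕ} (hN : 0 < N) (l : ℕ) (t : ℝ) : idx N l t < N ^ l :=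
  lt_of_le_of_lt (min_le_right _ _) (Nat.sub_lt (by positivity) one_pos)

theorem idx_le {N : ℕ} (hN : 0 < N) (l : ℕ) {t : ℝ} (h0 : 0 ≤ t) :
    (idx N l t : ℝ) / (N : ℝ) ^ l ≤ t := by
  rw [div_le_iff₀ (by positivity)]
  refine le_trans ?_ (Nat.floor_le (by positivity))
  exact Nat.cast_le.mpr (min_le_left _ _)

theorem le_idx {N : ℕ} (hN : 0 < N) (l : ℕ) {t : ℝ} (h1 : t ≤ 1) :
    t ≤ ((idx N l t : ℝ) + 1) / (N : ℝ) ^ l := by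
  have hp : (0 : ℝ) < (N : ℝ) ^ l := by positivity
  rw [le_div_iff₀ hp, idx]
  rcases min_choice ⌊t * (N : ℝ) ^ l⌋₊ (N ^ l - 1) with h | h <;> rw [h]
  · exact (Nat.lt_floor_add_one _).le
  · have : ((N ^ l - 1 : ℕ) : ℝ) + 1 = (N : ℝ) ^ l := by
      rw [Nat.cast_sub (Nat.one_le_pow _ _ hN)]; push_cast; ring
    rw [this]
    nlinarith

theorem idx_succ_div {N : ℕ} (hN : 0 < N) (l : ℕ) (t : ℝ) : idx N (l + 1) t / N = idx N l t := by
  have hmono : Monotone fun a : ℕ => a / N := fun a b h => Nat.div_le_div_right h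
  have h1 := hmono.map_min (a := ⌊t * (N : ℝ) ^ (l + 1)⌋₊) (b := N ^ (l + 1) - 1)
  rw [idx, h1, idx]
  congr 1
  · rw [← Nat.floor_div_natCast, pow_succ, ← mul_assoc, mul_div_assoc,
      div_self (by exact_mod_cast hN.ne'), mul_one]
  · rw [pow_succ]
    exact (pred_div_mod hN (by positivity)).1

theorem idx_mono (N l : ℕ) : Monotone (idx N l) := fun s t h =>
  min_le_min (Nat.floor_le_floor (mul_le_mul_of_nonneg_right h (by positivity))) le_rfl

theorem idx_le_idx_add_one {N : ℕ} (hN : 0 < N) (l : ℕ) {s t : ℝ}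
    (h : t ≤ s + 1 / (N : ℝ) ^ l) : idx N l t ≤ idx N l s + 1 := by
  have hp : (0 : ℝ) < (N : ℝ) ^ l := by positivity
  have h1 : ⌊t * (N : ℝ) ^ l⌋₊ ≤ ⌊s * (N : ℝ) ^ l⌋₊ + 1 := by
    rw [← Nat.lt_succ_iff, Nat.floor_lt' (by omega)]
    have h2 : t * (N : ℝ) ^ l ≤ s * (N : ℝ) ^ l + 1 := by
      have := mul_le_mul_of_nonneg_right h hp.le
      rw [add_mul, div_mul_cancel₀ _ hp.ne'] at this
      exact this
    have := Nat.lt_floor_add_one (s * (N : ℝ) ^ l)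
    push_cast
    linarith
  unfold idx
  omega

theorem idx_of_mem_Ico {N : ℕ} {l k : ℕ} (hk : k < N ^ l) {t : ℝ}
    (h0 : (k : ℝ) / (N : ℝ) ^ l ≤ t) (h1 : t < ((k : ℝ) + 1) / (N : ℝ) ^ l) : idx N l t = k := by
  have hp : (0 : ℝ) < (N : ℝ) ^ l := by exact_mod_cast (by omega : 0 < N ^ l)
  rw [div_le_iff₀ hp] at h0
  rw [lt_div_iff₀ hp] at h1
  have : ⌊t * (N : ℝ) ^ l⌋₊ = k :=
    (Nat.floor_eq_iff (le_trans (Nat.cast_nonneg k) h0)).mpr ⟨h0, h1⟩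
  rw [idx, this]
  omega

/-! ### Geometry of the cells -/

theorem continuous_app (T : Similarity d) : Continuous T.app := by
  unfold Similarity.app
  exact ((continuous_const.matrix_mulVec continuous_id).const_smul T.scale).add continuous_const

theorem isCompact_unitCube : IsCompact (unitCube d) := isCompact_Icc

theorem isCompact_cell (l k : ℕ) : IsCompact (cell d l k) :=
  isCompact_unitCube.image (continuous_app _)

theorem cell_nonempty (l k : ℕ) : (cell d l k).Nonempty := ⟨_, _, zero_mem_unitCube, rfl⟩

theorem cell_succ_subset (l k : ℕ) : cell d (l + 1) k ⊆ cell d l (k / 2 ^ d) := by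
  rintro _ ⟨x, hx, rfl⟩
  rw [cellMap_succ_app]
  exact ⟨_, trans_mem_unitCube _ hx, rfl⟩

theorem cell_zero (k : ℕ) : cell d 0 k = unitCube d := by
  simp only [cell, cellMap, Similarity.app_refl, Set.image_id']

theorem cell_subset_unitCube (l k : ℕ) : cell d l k ⊆ unitCube d := by
  induction l generalizing k with
  | zero => rw [cell_zero]
  | succ l ih => exact (cell_succ_subset l k).trans (ih _)

theorem dist_cellMap_le (l k : ℕ) (x y : Fin d → ℝ) :
    dist ((cellMap (Similarity.refl d) l k).app x) ((cellMap (Similarity.refl d) l k).app y) ≤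
      (1 / 2) ^ l * dist x y := by
  induction l generalizing k x y with
  | zero => simp [cellMap, Similarity.app_refl]
  | succ l ih =>
    rw [cellMap_succ_app, cellMap_succ_app, pow_succ, mul_assoc]
    exact (ih _ _ _).trans (mul_le_mul_of_nonneg_left (dist_trans_le _ _ _) (by positivity))

theorem dist_le_of_mem_cell {l k : ℕ} {x y : Fin d → ℝ} (hx : x ∈ cell d l k)
    (hy : y ∈ cell d l k) : dist x y ≤ (1 / 2) ^ l := by
  obtain ⟨p, hp, rfl⟩ := hx
  obtain ⟨q, hq, rfl⟩ := hy
  have h : dist p q ≤ 1 := by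
    rw [dist_pi_le_iff zero_le_one]
    intro i
    have h1 := mem_unitCube.mp hp i
    have h2 := mem_unitCube.mp hq i
    rw [Real.dist_eq, abs_le]
    constructor <;> linarith
  exact (dist_cellMap_le _ _ _ _).trans (mul_le_of_le_one_right (by positivity) h)

theorem eq_of_forall_dist_le {X : Type*} [MetricSpace X] {x y : X} (C : ℝ)
    (h : ∀ l : ℕ, dist x y ≤ C * (1 / 2) ^ l) : x = y := by
  have hlim : Tendsto (fun l : ℕ => C * (1 / 2 : ℝ) ^ l) atTop (𝓝 0) := by
    simpa using (tendsto_pow_atTop_nhds_zero_of_lt_one (by norm_num : (0 : ℝ) ≤ 1 / 2)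
      (by norm_num)).const_mul C
  exact dist_le_zero.mp (ge_of_tendsto' hlim h)

theorem exists_mem_subcell {l k : ℕ} {x : Fin d → ℝ} (hx : x ∈ cell d l k) (m : ℕ) :
    ∃ k', k' / (2 ^ d) ^ m = k ∧ x ∈ cell d (l + m) k' := by
  induction m with
  | zero => exact ⟨k, by simp, hx⟩
  | succ m ih =>
    obtain ⟨k', hk', y, hy, rfl⟩ := ih
    obtain ⟨r, z, hz, rfl⟩ := exists_trans_eq hy
    refine ⟨k' * 2 ^ d + r, ?_, z, hz, ?_⟩
    · rw [pow_succ', ← Nat.div_div_eq_div_mul, mul_add_div_two_pow, hk']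
    · rw [← add_assoc, cellMap_succ_app, mul_add_div_two_pow, lastRank_mul_add]

theorem volume_image_app (T : Similarity d) (s : Set (Fin d → ℝ)) :
    volume (T.app '' s) = ENNReal.ofReal (T.scale ^ d) * volume s := by
  have h1 : T.app '' s = (fun x => x + T.shift) '' ((T.scale • Matrix.toLin' T.rot.1) '' s) := by
    rw [Set.image_image]; rfl
  have hdet : |Matrix.det T.rot.1| = 1 := by
    have h := congrArg Matrix.det ((Matrix.mem_orthogonalGroup_iff _ _).mp T.rot.2)
    rw [Matrix.det_mul, Matrix.det_transpose, Matrix.det_one] at h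
    have : |Matrix.det T.rot.1| * |Matrix.det T.rot.1| = 1 := by
      rw [abs_mul_abs_self, h]
    nlinarith [abs_nonneg (Matrix.det T.rot.1)]
  rw [h1, Set.image_add_right, measure_preimage_add_right, Measure.addHaar_image_linearMap,
    LinearMap.det_smul, LinearMap.det_toLin', abs_mul, hdet, mul_one, Module.finrank_fin_fun,
    abs_of_pos (pow_pos T.scale_pos d)]

theorem cellMap_scale (l k : ℕ) :
    (cellMap (Similarity.refl d) l k).scale = (1 / 2) ^ l := by
  induction l generalizing k with
  | zero => rfl
  | succ l ih =>
    change (cellMap (Similarity.refl d) l (k / 2 ^ d)).scale * (1 / 2) = _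
    rw [ih, pow_succ]

theorem volume_cell (l k : ℕ) : volume (cell d l k) = ENNReal.ofReal (1 / ((2 ^ d : ℕ) : ℝ) ^ l) := by
  have h : volume (unitCube d) = 1 := by
    rw [unitCube, Real.volume_Icc_pi]; simp
  rw [cell, volume_image_app, h, mul_one, cellMap_scale]
  congr 1
  push_cast
  rw [← pow_mul, ← pow_mul, mul_comm l d, one_div, one_div, inv_pow]

theorem relVolume_eq {l i : ℕ} (hi : i ≤ (2 ^ d) ^ l) :
    (harmoniousOrder d).relVolume l i = (i : ℝ) / ((2 ^ d : ℕ) : ℝ) ^ l := by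
  set v : ℝ := 1 / ((2 ^ d : ℕ) : ℝ) ^ l with hv
  have hv0 : 0 < v := by positivity
  have h : (fun P : (harmoniousOrder d).Piece => volume.real P.region) ∘
      (fun k => mkPiece (cellMap (Similarity.refl d) l k)) = fun _ => v := by
    ext k
    change volume.real (cell d l k) = v
    rw [Measure.real, volume_cell, ENNReal.toReal_ofReal hv0.le]
  rw [ScanningOrder.relVolume, pieces_eq, ← List.map_take, List.map_map, List.map_map, h,
    List.map_const', List.map_const', List.sum_replicate, List.sum_replicate, List.length_take,
    List.length_range, min_eq_left hi, nsmul_eq_mul, nsmul_eq_mul, mul_div_mul_right _ _ hv0.ne']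
  push_cast
  rfl

/-! ### Construction of the curve -/

theorem exists_mem_cells (d : ℕ) (t : ℝ) : ∃ x, ∀ l, x ∈ cell d l (idx (2 ^ d) l t) := by
  have h := IsCompact.nonempty_iInter_of_sequence_nonempty_isCompact_isClosed
    (fun l => cell d l (idx (2 ^ d) l t))
    (fun l => by
      have := cell_succ_subset (d := d) l (idx (2 ^ d) (l + 1) t)
      rwa [idx_succ_div (by positivity)] at this)
    (fun l => cell_nonempty _ _) (isCompact_cell _ _) (fun l => (isCompact_cell _ _).isClosed)
  obtain ⟨x, hx⟩ := h
  exact ⟨x, fun l => Set.mem_iInter.mp hx l⟩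

/-- The point that the harmonious Hilbert curve visits at time `t`: the common point of the cells,
one for each depth of recursion, that are visited at time `t`. -/
noncomputable def point (d : ℕ) (t : ℝ) : Fin d → ℝ := (exists_mem_cells d t).choose

theorem point_mem_cell_idx (d l : ℕ) (t : ℝ) : point d t ∈ cell d l (idx (2 ^ d) l t) :=
  (exists_mem_cells d t).choose_spec l

/-- Points that are visited within a short time of each other lie in the same cell or in consecutive
cells, which share a vertex. -/
theorem dist_point_le (d l : ℕ) {s t : ℝ} (hst : s ≤ t) (h : t ≤ s + 1 / ((2 ^ d : ℕ) : ℝ) ^ l) :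
    dist (point d s) (point d t) ≤ 2 * (1 / 2) ^ l := by
  have hN : 0 < 2 ^ d := by positivity
  have h1 := idx_mono (2 ^ d) l hst
  have h2 := idx_le_idx_add_one hN l h
  have hs := point_mem_cell_idx d l s
  have ht := point_mem_cell_idx d l t
  rcases Nat.eq_or_lt_of_le h1 with he | hlt
  · rw [← he] at ht
    have := dist_le_of_mem_cell hs ht
    have hp : (0 : ℝ) < (1 / 2) ^ l := by positivity
    linarith
  · have he : idx (2 ^ d) l t = idx (2 ^ d) l s + 1 := by omega
    have hlt := idx_lt hN l t
    rw [he] at ht hlt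
    have hc := cellMap_consecutive (Similarity.refl d) l _ hlt
    have h3 := dist_le_of_mem_cell hs ⟨_, endPoint_mem_unitCube, rfl⟩
    have h4 := dist_le_of_mem_cell (⟨_, zero_mem_unitCube, rfl⟩ : _ ∈ cell d l _) ht
    rw [hc] at h3
    linarith [dist_triangle (point d s)
      ((cellMap (Similarity.refl d) l (idx (2 ^ d) l s + 1)).app 0) (point d t)]

theorem continuous_point (d : ℕ) : Continuous (point d) := by
  rw [Metric.continuous_iff]
  intro t ε hε
  have hlim : Tendsto (fun l : ℕ => 2 * (1 / 2 : ℝ) ^ l) atTop (𝓝 0) := by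
    simpa using (tendsto_pow_atTop_nhds_zero_of_lt_one (by norm_num : (0 : ℝ) ≤ 1 / 2)
      (by norm_num)).const_mul (2 : ℝ)
  obtain ⟨l, hl⟩ := (hlim.eventually (gt_mem_nhds hε)).exists
  refine ⟨1 / ((2 ^ d : ℕ) : ℝ) ^ l, by positivity, fun s hs => ?_⟩
  rw [Real.dist_eq, abs_lt] at hs
  refine lt_of_le_of_lt ?_ hl
  rcases le_total s t with h | h
  · exact dist_point_le d l h (by linarith)
  · rw [dist_comm]
    exact dist_point_le d l h (by linarith)

theorem point_mem_cell {l k : ℕ} (hk : k < (2 ^ d) ^ l) {t : ℝ}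
    (ht : t ∈ Set.Icc ((k : ℝ) / ((2 ^ d : ℕ) : ℝ) ^ l) (((k : ℝ) + 1) / ((2 ^ d : ℕ) : ℝ) ^ l)) :
    point d t ∈ cell d l k := by
  have hp : (0 : ℝ) < ((2 ^ d : ℕ) : ℝ) ^ l := by positivity
  have hne : (k : ℝ) / ((2 ^ d : ℕ) : ℝ) ^ l ≠ ((k : ℝ) + 1) / ((2 ^ d : ℕ) : ℝ) ^ l := by
    intro h
    rw [div_left_inj' hp.ne'] at h
    linarith
  rw [← closure_Ico hne] at ht
  have h1 := (continuous_point d).continuousOn.image_closure ⟨t, ht, rfl⟩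
  refine (isCompact_cell l k).isClosed.closure_subset_iff.mpr ?_ h1
  rintro _ ⟨s, hs, rfl⟩
  have := point_mem_cell_idx d l s
  rwa [idx_of_mem_Ico hk hs.1 hs.2] at this

/-- Each point of a cell is visited during the time interval of that cell: subcells around the point
yield visits arbitrarily close to it, and the image of a closed interval is closed. -/
theorem image_point_Icc {l k : ℕ} (hk : k < (2 ^ d) ^ l) :
    point d '' Set.Icc ((k : ℝ) / ((2 ^ d : ℕ) : ℝ) ^ l) (((k : ℝ) + 1) / ((2 ^ d : ℕ) : ℝ) ^ l) =
      cell d l k := by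
  apply Set.Subset.antisymm
  · rintro _ ⟨t, ht, rfl⟩
    exact point_mem_cell hk ht
  · intro x hx
    have hcl := (isCompact_Icc.image (continuous_point d)).isClosed (X := Fin d → ℝ)
      (s := point d '' Set.Icc ((k : ℝ) / ((2 ^ d : ℕ) : ℝ) ^ l)
        (((k : ℝ) + 1) / ((2 ^ d : ℕ) : ℝ) ^ l))
    rw [← hcl.closure_eq, Metric.mem_closure_iff]
    intro ε hε
    obtain ⟨m, hm⟩ := exists_pow_lt_of_lt_one hε (by norm_num : (1 / 2 : ℝ) < 1)
    obtain ⟨k', hk', hx'⟩ := exists_mem_subcell hx m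
    have hpm : 0 < (2 ^ d) ^ m := by positivity
    have hk'lt : k' < (2 ^ d) ^ (l + m) := by
      rw [pow_add, ← Nat.div_lt_iff_lt_mul hpm, hk']
      exact hk
    have hpl : (0 : ℝ) < ((2 ^ d : ℕ) : ℝ) ^ l := by positivity
    have hpm' : (0 : ℝ) < ((2 ^ d : ℕ) : ℝ) ^ m := by positivity
    have hplm : (0 : ℝ) < ((2 ^ d : ℕ) : ℝ) ^ (l + m) := by positivity
    have hlow : k * (2 ^ d) ^ m ≤ k' := by rw [← hk']; exact Nat.div_mul_le_self _ _
    have hhigh : k' ≤ (k + 1) * (2 ^ d) ^ m := by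
      rw [← hk', mul_comm]; exact (Nat.lt_mul_div_succ k' hpm).le
    have hlow' : (k : ℝ) * ((2 ^ d : ℕ) : ℝ) ^ m ≤ k' := by exact_mod_cast hlow
    have hhigh' : (k' : ℝ) ≤ ((k : ℝ) + 1) * ((2 ^ d : ℕ) : ℝ) ^ m := by exact_mod_cast hhigh
    refine ⟨_, ⟨(k' : ℝ) / ((2 ^ d : ℕ) : ℝ) ^ (l + m), ⟨?_, ?_⟩, rfl⟩, ?_⟩
    · rw [div_le_div_iff₀ hpl hplm, pow_add]
      nlinarith
    · rw [div_le_div_iff₀ hplm hpl, pow_add]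
      nlinarith
    · have h1 : point d ((k' : ℝ) / ((2 ^ d : ℕ) : ℝ) ^ (l + m)) ∈ cell d (l + m) k' :=
        point_mem_cell hk'lt ⟨le_rfl, by gcongr; linarith⟩
      refine lt_of_le_of_lt (dist_le_of_mem_cell hx' h1) (lt_of_le_of_lt ?_ hm)
      exact pow_le_pow_of_le_one (by norm_num) (by norm_num) (by omega)

theorem point_mem_unitCube (d : ℕ) (t : ℝ) : point d t ∈ unitCube d :=
  cell_subset_unitCube _ _ (point_mem_cell_idx d 0 t)

/-- The `d`-dimensional harmonious Hilbert curve. -/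
noncomputable def curve (d : ℕ) : Curve d where
  toFun t i := ⟨point d t i, mem_unitCube.mp (point_mem_unitCube d t) i⟩
  continuous_toFun := continuous_pi fun i => Continuous.subtype_mk
    ((continuous_apply i).comp ((continuous_point d).comp continuous_subtype_val)) _
  surjective_toFun p := by
    have hp : (fun i => (p i : ℝ)) ∈ cell d 0 0 := by
      rw [cell_zero]; exact mem_unitCube.mpr fun i => (p i).2
    rw [← image_point_Icc (by simp)] at hp
    obtain ⟨t, ht, h⟩ := hp
    refine ⟨⟨t, by simpa using ht⟩, ?_⟩
    ext i
    exact congrFun h i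

theorem coe_curve_apply (d : ℕ) (t : I) :
    (fun i => (((curve d).toFun t i : I) : ℝ)) = point d t := rfl

theorem curve_mem (d : ℕ) : curve d ∈ harmoniousHilbert d := by
  intro l i hi
  have hi' : i < (2 ^ d) ^ l := by simpa [pieces_eq] using hi
  have hp : (0 : ℝ) < ((2 ^ d : ℕ) : ℝ) ^ l := by positivity
  have hreg : (((harmoniousOrder d).pieces l)[i]).region = cell d l i := by
    simp only [pieces_eq, List.getElem_map, List.getElem_range]
    rfl
  rw [hreg, relVolume_eq hi'.le, relVolume_eq hi', ← image_point_Icc hi']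
  push_cast
  ext x
  constructor
  · rintro ⟨t, ht, rfl⟩
    exact ⟨t, ht, rfl⟩
  · rintro ⟨t, ht, h⟩
    have h1 : ((i : ℝ) + 1) / ((2 : ℝ) ^ d) ^ l ≤ 1 := by
      rw [div_le_one (by positivity)]
      exact_mod_cast hi'
    refine ⟨⟨t, le_trans (by positivity) ht.1, ht.2.trans h1⟩, ht, ?_⟩
    ext j
    exact congrFun h j

theorem curve_ext {f g : Curve d} (h : ∀ t, f.toFun t = g.toFun t) : f = g := by
  cases f; cases g
  congr
  exact funext h

theorem eq_curve_of_mem {f : Curve d} (hf : f ∈ harmoniousHilbert d) : f = curve d := by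
  refine curve_ext fun t => ?_
  have h : (fun i => ((f.toFun t i : I) : ℝ)) = point d t := by
    refine eq_of_forall_dist_le 1 fun l => ?_
    have hN : 0 < 2 ^ d := by positivity
    have hlt := idx_lt hN l (t : ℝ)
    have hi : idx (2 ^ d) l t < ((harmoniousOrder d).pieces l).length := by
      simpa [pieces_eq] using hlt
    have hreg : (((harmoniousOrder d).pieces l)[idx (2 ^ d) l t]).region =
        cell d l (idx (2 ^ d) l t) := by
      simp only [pieces_eq, List.getElem_map, List.getElem_range]
      rfl
    have h1 := hf l _ hi
    rw [hreg, relVolume_eq hlt.le, relVolume_eq hlt] at h1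
    have h3 : f.toFun t ∈ {x : Fin d → I | (fun j => (x j : ℝ)) ∈ cell d l (idx (2 ^ d) l t)} := by
      rw [← h1]
      refine ⟨t, ⟨idx_le hN l t.2.1, ?_⟩, rfl⟩
      have := le_idx hN l t.2.2
      exact_mod_cast this
    rw [one_mul]
    exact dist_le_of_mem_cell h3 (point_mem_cell_idx d l t)
  ext i
  exact congrFun h i

/-! ### The curve that is seen on a face -/

variable {n : ℕ}

/-- The face that the `(n+1)`-dimensional curve has within the cell that corresponds to cell number
`κ` of depth `l` of the `n`-dimensional curve, if one looks at face `s`. A face `(i, k)` is given by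
an axis `i` and a side `k`. -/
def faceState (s : Fin (n + 1) × Bool) : ℕ → ℕ → Fin (n + 1) × Bool
  | 0, _ => s
  | l + 1, κ =>
    let u := faceState s l (κ / 2 ^ n)
    (nextAxis u.1 u.2 (lastRank n κ), nextSide u.1 u.2 (lastRank n κ))

/-- The number of the cell of depth `l` of the `(n+1)`-dimensional curve that shows cell number `κ`
of depth `l` of the `n`-dimensional curve on face `s`. At depth `0` only `κ = 0` has a meaning; the
other values make the function strictly monotone on all of `ℕ`. -/
def faceIdx (s : Fin (n + 1) × Bool) : ℕ → ℕ → ℕ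
  | 0, κ => κ
  | l + 1, κ =>
    let u := faceState s l (κ / 2 ^ n)
    faceIdx s l (κ / 2 ^ n) * 2 ^ (n + 1) + faceRank u.1 u.2 (lastRank n κ)

theorem faceIdx_succ_div (s : Fin (n + 1) × Bool) (l κ : ℕ) :
    faceIdx s (l + 1) κ / 2 ^ (n + 1) = faceIdx s l (κ / 2 ^ n) := by
  rw [faceIdx, mul_add_div_two_pow]

theorem lastRank_faceIdx_succ (s : Fin (n + 1) × Bool) (l κ : ℕ) :
    lastRank (n + 1) (faceIdx s (l + 1) κ) = faceRank (faceState s l (κ / 2 ^ n)).1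
      (faceState s l (κ / 2 ^ n)).2 (lastRank n κ) := by
  rw [faceIdx, lastRank_mul_add]

theorem faceIdx_strictMono (s : Fin (n + 1) × Bool) (l : ℕ) : StrictMono (faceIdx s l) := by
  induction l with
  | zero => exact fun a b h => h
  | succ l ih =>
    intro a b hab
    have hle : a / 2 ^ n ≤ b / 2 ^ n := Nat.div_le_div_right hab.le
    rw [faceIdx, faceIdx]
    rcases hle.lt_or_eq with h | h
    · have h1 := ih h
      generalize faceIdx s l (a / 2 ^ n) = p at *
      generalize faceIdx s l (b / 2 ^ n) = q at *
      generalize hx : faceRank (faceState s l (a / 2 ^ n)).1 (faceState s l (a / 2 ^ n)).2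
        (lastRank n a) = x
      have h2 := x.isLt
      have h3 := Nat.mul_le_mul_right (2 ^ (n + 1)) (Nat.succ_le_of_lt h1)
      rw [Nat.succ_mul] at h3
      omega
    · rw [h]
      refine Nat.add_lt_add_left ?_ _
      apply insBit_strictMono
      have h1 := Nat.div_add_mod a (2 ^ n)
      have h2 := Nat.div_add_mod b (2 ^ n)
      rw [h] at h1
      change a % 2 ^ n < b % 2 ^ n
      omega

theorem faceIdx_lt (s : Fin (n + 1) × Bool) {l κ : ℕ} (h : κ < (2 ^ n) ^ l) :
    faceIdx s l κ < (2 ^ (n + 1)) ^ l := by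
  induction l generalizing κ with
  | zero => simpa [faceIdx] using h
  | succ l ih =>
    rw [pow_succ, ← Nat.div_lt_iff_lt_mul (by positivity), faceIdx_succ_div]
    apply ih
    rwa [Nat.div_lt_iff_lt_mul (by positivity), ← pow_succ]

theorem visible_faceState (hn : 1 ≤ n) {s : Fin (n + 1) × Bool} (hs : Visible s.1 s.2) (l κ : ℕ) :
    Visible (faceState s l κ).1 (faceState s l κ).2 := by
  induction l generalizing κ with
  | zero => exact hs
  | succ l ih => exact visible_next hn (ih _) _

theorem cellMap_faceIdx (hn : 1 ≤ n) {s : Fin (n + 1) × Bool} (hs : Visible s.1 s.2) {l κ : ℕ}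
    (y : Fin n → ℝ) : (cellMap (Similarity.refl (n + 1)) l (faceIdx s l κ)).app
      (faceEmb (faceState s l κ).1 (faceState s l κ).2 y) =
        faceEmb s.1 s.2 ((cellMap (Similarity.refl n) l κ).app y) := by
  induction l generalizing κ y with
  | zero => simp [cellMap, Similarity.app_refl, faceState]
  | succ l ih =>
    rw [cellMap_succ_app, cellMap_succ_app, faceIdx_succ_div, lastRank_faceIdx_succ, ← ih,
      ← trans_faceRank hn (visible_faceState hn hs l _)]
    rfl

theorem faceEmb_mem_unitCube (i : Fin (n + 1)) (k : Bool) {y : Fin n → ℝ} (hy : y ∈ unitCube n) :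
    faceEmb i k y ∈ unitCube (n + 1) := by
  rw [mem_unitCube] at hy ⊢
  intro l
  refine Fin.succAboveCases i ?_ (fun j => ?_) l
  · rw [faceEmb, Fin.insertNth_apply_same]
    cases k <;> simp [bval]
  · rw [faceEmb, Fin.insertNth_apply_succAbove]
    exact flip_mem (hy j).1 (hy j).2

theorem faceEmb_mem_cell (hn : 1 ≤ n) {s : Fin (n + 1) × Bool} (hs : Visible s.1 s.2) {l κ : ℕ}
    {x : Fin n → ℝ} (hx : x ∈ cell n l κ) : faceEmb s.1 s.2 x ∈ cell (n + 1) l (faceIdx s l κ) := by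
  obtain ⟨y, hy, rfl⟩ := hx
  exact ⟨_, faceEmb_mem_unitCube _ _ hy, cellMap_faceIdx hn hs y⟩

/-- The time interval during which the `(n+1)`-dimensional curve traverses the cell of depth `l`
that shows the point that the `n`-dimensional curve visits at time `t`. -/
def faceInterval (s : Fin (n + 1) × Bool) (t : ℝ) (l : ℕ) : Set ℝ :=
  Set.Icc ((faceIdx s l (idx (2 ^ n) l t) : ℝ) / ((2 ^ (n + 1) : ℕ) : ℝ) ^ l)
    (((faceIdx s l (idx (2 ^ n) l t) : ℝ) + 1) / ((2 ^ (n + 1) : ℕ) : ℝ) ^ l)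

theorem exists_mem_faceInterval (s : Fin (n + 1) × Bool) (t : ℝ) :
    ∃ x, ∀ l, x ∈ faceInterval s t l := by
  have h := IsCompact.nonempty_iInter_of_sequence_nonempty_isCompact_isClosed (faceInterval s t)
    (fun l => by
      have h1 := faceIdx_succ_div s l (idx (2 ^ n) (l + 1) t)
      rw [idx_succ_div (by positivity)] at h1
      unfold faceInterval
      have h0 : 0 < 2 ^ (n + 1) := by positivity
      generalize faceIdx s (l + 1) (idx (2 ^ n) (l + 1) t) = a at *
      generalize faceIdx s l (idx (2 ^ n) l t) = b at *
      generalize 2 ^ (n + 1) = M at *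
      have h2 : b * M ≤ a := by rw [← h1]; exact Nat.div_mul_le_self _ _
      have h3 : a + 1 ≤ (b + 1) * M := by
        rw [← h1, mul_comm]; exact Nat.lt_mul_div_succ a h0
      have h2' : (b : ℝ) * M ≤ a := by exact_mod_cast h2
      have h3' : (a : ℝ) + 1 ≤ (b + 1) * M := by exact_mod_cast h3
      have hM : (0 : ℝ) < M := by exact_mod_cast h0
      have hMl : (0 : ℝ) < (M : ℝ) ^ l := by positivity
      apply Set.Icc_subset_Icc
      · rw [div_le_div_iff₀ hMl (by positivity), pow_succ]
        nlinarith
      · rw [div_le_div_iff₀ (by positivity) hMl, pow_succ]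
        nlinarith)
    (fun l => Set.nonempty_Icc.mpr (by gcongr; linarith)) isCompact_Icc (fun l => isClosed_Icc)
  obtain ⟨x, hx⟩ := h
  exact ⟨x, fun l => Set.mem_iInter.mp hx l⟩

/-- The time at which the `(n+1)`-dimensional curve visits the point on face `s` that corresponds to
the point that the `n`-dimensional curve visits at time `t`. -/
noncomputable def faceTime (s : Fin (n + 1) × Bool) (t : ℝ) : ℝ :=
  (exists_mem_faceInterval s t).choose

theorem faceTime_mem (s : Fin (n + 1) × Bool) (t : ℝ) (l : ℕ) :
    faceTime s t ∈ faceInterval s t l :=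
  (exists_mem_faceInterval s t).choose_spec l

theorem faceTime_mem_unitInterval (s : Fin (n + 1) × Bool) (t : ℝ) : faceTime s t ∈ I := by
  have := faceTime_mem s t 0
  simpa [faceInterval, faceIdx, idx] using this

/-- Both points lie in a common cell at every depth of recursion. -/
theorem point_faceTime (hn : 1 ≤ n) {s : Fin (n + 1) × Bool} (hs : Visible s.1 s.2) (t : ℝ) :
    point (n + 1) (faceTime s t) = faceEmb s.1 s.2 (point n t) := by
  refine eq_of_forall_dist_le 1 fun l => ?_
  rw [one_mul]
  exact dist_le_of_mem_cell
    (point_mem_cell (faceIdx_lt s (idx_lt (by positivity) l t)) (faceTime_mem s t l))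
    (faceEmb_mem_cell hn hs (point_mem_cell_idx n l t))

theorem faceTime_lt (hn : 1 ≤ n) (s : Fin (n + 1) × Bool) {t u : ℝ} (ht : 0 ≤ t) (hu : u ≤ 1)
    (h : t < u) : faceTime s t < faceTime s u := by
  -- at sufficient depth, the cells visited at times `t` and `u` are not adjacent in the order
  obtain ⟨l, hl⟩ : ∃ l : ℕ, idx (2 ^ n) l t + 2 ≤ idx (2 ^ n) l u := by
    have h2 : (1 : ℝ) < ((2 ^ n : ℕ) : ℝ) := by
      exact_mod_cast Nat.one_lt_two_pow (by omega)
    obtain ⟨l, hl⟩ := pow_unbounded_of_one_lt (2 / (u - t)) h2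
    refine ⟨l, ?_⟩
    rw [div_lt_iff₀ (sub_pos.mpr h)] at hl
    have hp : (0 : ℝ) < ((2 ^ n : ℕ) : ℝ) ^ l := by positivity
    have h3 := idx_le (N := 2 ^ n) (by positivity) l ht
    have h4 := le_idx (N := 2 ^ n) (by positivity) l hu
    rw [div_le_iff₀ hp] at h3
    rw [le_div_iff₀ hp] at h4
    have h5 : (2 : ℝ) + idx (2 ^ n) l t < idx (2 ^ n) l u + 1 := by nlinarith
    have h6 : 2 + idx (2 ^ n) l t < idx (2 ^ n) l u + 1 := by exact_mod_cast h5
    omega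
  have h1 := (faceTime_mem s t l).2
  have h2 := (faceTime_mem s u l).1
  have hm := faceIdx_strictMono s l
  have h3 : faceIdx s l (idx (2 ^ n) l t) + 1 < faceIdx s l (idx (2 ^ n) l u) := by
    have e1 := hm (Nat.lt_succ_self (idx (2 ^ n) l t))
    have e2 := hm (show idx (2 ^ n) l t + 1 < idx (2 ^ n) l u by omega)
    rw [Nat.succ_eq_add_one] at e1
    omega
  have h4 : (faceIdx s l (idx (2 ^ n) l t) : ℝ) + 1 < faceIdx s l (idx (2 ^ n) l u) := by
    exact_mod_cast h3
  refine lt_of_le_of_lt h1 (lt_of_lt_of_le ?_ h2)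
  gcongr

theorem exists_strictMono_face (hn : 1 ≤ n) {i : Fin (n + 1)} {k : Bool} (hik : Visible i k) :
    ∃ Φ : I → I, StrictMono Φ ∧ ∀ t : I, point (n + 1) (Φ t) = faceEmb i k (point n t) :=
  ⟨fun t => ⟨faceTime (i, k) t, faceTime_mem_unitInterval _ _⟩,
    fun t u h => faceTime_lt hn _ t.2.1 u.2.2 h, fun t => point_faceTime hn hik t⟩

theorem exists_strictMono_front (hn : 1 ≤ n) (i : Fin (n + 1)) :
    ∃ Φ : I → I, StrictMono Φ ∧
      ∀ t, (curve (n + 1)).toFun (Φ t) = i.insertNth 0 ((curve n).toFun t) := by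
  obtain ⟨Φ, h1, h2⟩ := exists_strictMono_face hn (i := i) (k := false) (fun h => by simp at h)
  refine ⟨Φ, h1, fun t => ?_⟩
  ext l
  have h3 := congrFun (h2 t) l
  rw [← coe_curve_apply] at h3
  dsimp only at h3
  rw [h3]
  refine Fin.succAboveCases i ?_ (fun j => ?_) l
  · simp [faceEmb, bval]
  · simp [faceEmb, flip, curve]

theorem exists_strictMono_back (hn : 1 ≤ n) (i : Fin n) :
    ∃ Φ : I → I, StrictMono Φ ∧
      ∀ t, (curve (n + 1)).toFun (Φ t) = i.castSucc.insertNth 1 (((curve n).mirror i).toFun t) := by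
  obtain ⟨Φ, h1, h2⟩ := exists_strictMono_face hn (i := i.castSucc) (k := true)
    (fun _ => i.isLt.ne)
  refine ⟨Φ, h1, fun t => ?_⟩
  ext l
  have h3 := congrFun (h2 t) l
  rw [← coe_curve_apply] at h3
  dsimp only at h3
  rw [h3]
  refine Fin.succAboveCases i.castSucc ?_ (fun j => ?_) l
  · simp [faceEmb, bval]
  · rw [faceEmb, Fin.insertNth_apply_succAbove, Fin.insertNth_apply_succAbove]
    by_cases hj : j = i
    · subst hj
      simp [flip, curve, Curve.mirror]
    · have : ¬ (j : ℕ) = i := fun h => hj (Fin.ext h)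
      simp [flip, curve, Curve.mirror, hj, this]

end Harmonious

namespace Curve

variable {n : ℕ}

/-- If `g` traverses a copy of `h` on a face in the same order, then each valid ordering of `h`
extends to a valid ordering of `g`. -/
theorem exists_isValidOrdering_of_face {g : Curve (n + 1)} {h : Curve n} {i : Fin (n + 1)} {k : I}
    {Φ : I → I} (hΦ : ∀ t, g.toFun (Φ t) = i.insertNth k (h.toFun t)) {e : (Fin n → I) → I}
    (he : h.IsValidOrdering e) :
    ∃ o, g.IsValidOrdering o ∧ ∀ x, x i = k → o x = Φ (e (i.removeNth x)) := by
  classical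
  choose r hr using g.surjective_toFun
  refine ⟨fun x => if x i = k then Φ (e (i.removeNth x)) else r x, fun x => ?_, fun x hx => if_pos hx⟩
  dsimp only
  by_cases hx : x i = k
  · rw [if_pos hx, hΦ, he, ← hx, Fin.insertNth_self_removeNth]
  · rw [if_neg hx, hr]

/-- For a curve that does not fill regions faster than at unit speed, the points that are visited
within a time interval have the same measure as the interval, regardless of the choice of the valid
ordering. -/
theorem volume_setOf_isValidOrdering {h : Curve n}
    (hvol : ∀ s t : I, s ≤ t → volume (h.toFun '' Set.Icc s t) ≤ ENNReal.ofReal ((t : ℝ) - s))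
    {e : (Fin n → I) → I} (he : h.IsValidOrdering e) {s t : I} (hst : s ≤ t) :
    volume {p | s ≤ e p ∧ e p ≤ t} = ENNReal.ofReal ((t : ℝ) - s) := by
  apply le_antisymm
  · refine le_trans (measure_mono ?_) (hvol s t hst)
    intro p hp
    exact ⟨e p, hp, he p⟩
  · have h1 : (Set.univ : Set (Fin n → I)) ⊆ ({p | s ≤ e p ∧ e p ≤ t} ∪ h.toFun '' Set.Icc 0 s) ∪
        h.toFun '' Set.Icc t 1 := by
      intro p _
      rcases le_total (e p) s with h1 | h1
      · exact Or.inl (Or.inr ⟨e p, ⟨unitInterval.nonneg _, h1⟩, he p⟩)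
      · rcases le_total (e p) t with h2 | h2
        · exact Or.inl (Or.inl ⟨h1, h2⟩)
        · exact Or.inr ⟨e p, ⟨h2, unitInterval.le_one _⟩, he p⟩
    have h2 := (measure_mono (μ := volume) h1).trans ((measure_union_le _ _).trans
      (add_le_add (measure_union_le _ _) le_rfl))
    have h3 := hvol 0 s (unitInterval.nonneg _)
    have h4 := hvol t 1 (unitInterval.le_one _)
    rw [measure_univ] at h2
    have h5 := h2.trans (add_le_add (add_le_add le_rfl h3) h4)
    have hst' : (s : ℝ) ≤ t := hst
    have h6 : (1 : ENNReal) = ENNReal.ofReal ((t : ℝ) - s) + ENNReal.ofReal ((s : ℝ) - (0 : I)) +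
        ENNReal.ofReal (((1 : I) : ℝ) - t) := by
      rw [← ENNReal.ofReal_add (by linarith) (by simpa using s.2.1),
        ← ENNReal.ofReal_add (by simpa using t.2.1) (by simpa using t.2.2), ← ENNReal.ofReal_one]
      congr 1
      simp
    rw [h6] at h5
    exact (ENNReal.add_le_add_iff_right ENNReal.ofReal_ne_top).mp
      ((ENNReal.add_le_add_iff_right ENNReal.ofReal_ne_top).mp h5)

theorem shows_of_face {g : Curve (n + 1)} {h : Curve n} {i : Fin (n + 1)} {k : I} {Φ : I → I}
    (hmono : StrictMono Φ) (hΦ : ∀ t, g.toFun (Φ t) = i.insertNth k (h.toFun t))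
    (hvol : ∀ s t : I, s ≤ t → volume (h.toFun '' Set.Icc s t) ≤ ENNReal.ofReal ((t : ℝ) - s)) :
    g.Shows h i k := by
  intro e he
  obtain ⟨o, ho, hoe⟩ := exists_isValidOrdering_of_face hΦ he
  refine ⟨o, ho, fun a b ha hb => ?_, fun s t hst => volume_setOf_isValidOrdering hvol he hst⟩
  rw [hoe a ha, hoe b hb, hmono.lt_iff_lt]

theorem volume_image_mirror {h : Curve n} (i : Fin n) (s t : I) :
    volume ((h.mirror i).toFun '' Set.Icc s t) = volume (h.toFun '' Set.Icc s t) := by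
  let R : (Fin n → I) → (Fin n → I) := fun a j => (if j = i then σ else id) (a j)
  have hR : MeasurePreserving R volume volume := by
    refine volume_preserving_pi (f := fun j => if j = i then σ else id) fun j => ?_
    split_ifs
    · exact unitInterval.measurePreserving_symm
    · exact MeasurePreserving.id _
  have hRR : ∀ a, R (R a) = a := fun a => by
    ext j
    by_cases hj : j = i <;> simp [R, hj]
  have hmR : ∀ u, (h.mirror i).toFun u = R (h.toFun u) := fun u => by
    ext j
    by_cases hj : j = i
    · subst hj; simp [R, mirror]
    · simp [R, mirror, hj]
  have himg : (h.mirror i).toFun '' Set.Icc s t = R ⁻¹' (h.toFun '' Set.Icc s t) := by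
    ext p
    constructor
    · rintro ⟨u, hu, rfl⟩
      exact ⟨u, hu, by rw [hmR, hRR]⟩
    · rintro ⟨u, hu, hp⟩
      exact ⟨u, hu, by rw [hmR, hp, hRR]⟩
  rw [himg, hR.measure_preimage]
  exact (isCompact_Icc.image h.continuous_toFun).isClosed.measurableSet.nullMeasurableSet

end Curve

namespace Harmonious

variable {n : ℕ}

theorem volume_preimage_cell (l k : ℕ) :
    volume {x : Fin n → I | (fun j => (x j : ℝ)) ∈ cell n l k} ≤
      ENNReal.ofReal (1 / ((2 ^ n : ℕ) : ℝ) ^ l) := by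
  have h1 : MeasurePreserving (fun (x : Fin n → I) (j : Fin n) => (x j : ℝ)) volume
      (Measure.pi fun _ => (volume : Measure ℝ).restrict I) :=
    measurePreserving_pi _ _ fun _ => unitInterval.measurePreserving_coe
  rw [← volume_cell (d := n) l k]
  change volume ((fun (x : Fin n → I) (j : Fin n) => (x j : ℝ)) ⁻¹' cell n l k) ≤ _
  rw [h1.measure_preimage (isCompact_cell l k).isClosed.measurableSet.nullMeasurableSet,
    ← Measure.restrict_pi_pi]
  exact Measure.restrict_apply_le _ _

/-- The curve fills regions at unit speed. -/
theorem volume_image_curve_le (hn : 1 ≤ n) {s t : I} (hst : s ≤ t) :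
    volume ((curve n).toFun '' Set.Icc s t) ≤ ENNReal.ofReal ((t : ℝ) - s) := by
  have hN : 0 < 2 ^ n := by positivity
  have h1N : (1 : ℝ) < ((2 ^ n : ℕ) : ℝ) := by exact_mod_cast Nat.one_lt_two_pow (by omega)
  have key : ∀ l : ℕ, volume ((curve n).toFun '' Set.Icc s t) ≤
      ENNReal.ofReal ((t : ℝ) - s + 2 * ((((2 ^ n : ℕ) : ℝ))⁻¹) ^ l) := by
    intro l
    set a := idx (2 ^ n) l s
    set b := idx (2 ^ n) l t
    have hsub : (curve n).toFun '' Set.Icc s t ⊆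
        ⋃ k ∈ Finset.Icc a b, {x : Fin n → I | (fun j => (x j : ℝ)) ∈ cell n l k} := by
      rintro _ ⟨u, hu, rfl⟩
      refine Set.mem_biUnion (x := idx (2 ^ n) l u) ?_ (point_mem_cell_idx n l u)
      exact Finset.mem_coe.mpr (Finset.mem_Icc.mpr ⟨idx_mono _ l hu.1, idx_mono _ l hu.2⟩)
    refine (measure_mono hsub).trans ((measure_biUnion_finset_le _ _).trans
      ((Finset.sum_le_sum fun k _ => volume_preimage_cell l k).trans ?_))
    have hp : (0 : ℝ) < ((2 ^ n : ℕ) : ℝ) ^ l := by positivity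
    have hab : a ≤ b := idx_mono _ l hst
    rw [Finset.sum_const, Nat.card_Icc, nsmul_eq_mul, ← ENNReal.ofReal_natCast,
      ← ENNReal.ofReal_mul (Nat.cast_nonneg _)]
    apply ENNReal.ofReal_le_ofReal
    have h1 := le_idx hN l s.2.2
    have h2 := idx_le hN l t.2.1
    rw [Nat.cast_sub (by omega)]
    push_cast at h1 h2 ⊢
    have e : ((b : ℝ) + 1 - a) * (1 / ((2 : ℝ) ^ n) ^ l) = b / ((2 : ℝ) ^ n) ^ l -
      (a + 1) / ((2 : ℝ) ^ n) ^ l + 2 * (((2 : ℝ) ^ n)⁻¹) ^ l := by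
      rw [inv_pow]; field_simp; ring
    rw [e]
    linarith
  have hlim : Tendsto (fun l : ℕ => ENNReal.ofReal ((t : ℝ) - s + 2 * ((((2 ^ n : ℕ) : ℝ))⁻¹) ^ l))
      atTop (𝓝 (ENNReal.ofReal ((t : ℝ) - s))) := by
    apply ENNReal.tendsto_ofReal
    have := ((tendsto_pow_atTop_nhds_zero_of_lt_one (by positivity : (0 : ℝ) ≤ ((2 ^ n : ℕ) : ℝ)⁻¹)
      (inv_lt_one_of_one_lt₀ h1N)).const_mul 2).const_add ((t : ℝ) - s)
    simpa using this
  exact ge_of_tendsto' hlim key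

theorem curve_shows_front (hn : 1 ≤ n) (i : Fin (n + 1)) : (curve (n + 1)).Shows (curve n) i 0 := by
  obtain ⟨Φ, h1, h2⟩ := exists_strictMono_front hn i
  exact Curve.shows_of_face h1 h2 fun s t hst => volume_image_curve_le hn hst

theorem curve_shows_back (hn : 1 ≤ n) (i : Fin n) :
    (curve (n + 1)).Shows ((curve n).mirror i) i.castSucc 1 := by
  obtain ⟨Φ, h1, h2⟩ := exists_strictMono_back hn i
  refine Curve.shows_of_face h1 h2 fun s t hst => ?_
  rw [Curve.volume_image_mirror]
  exact volume_image_curve_le hn hst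

/-! ### Interdimensional consistency -/

/-- Coordinates are added one at a time, each time by placing the lower-dimensional curve on a front
face of the next one. -/
theorem exists_isValidOrdering_lift (hn : 1 ≤ n) (m : ℕ) {e : (Fin n → I) → I}
    (he : (curve n).IsValidOrdering e) (μ : Fin n → Fin (n + m)) (hμ : StrictMono μ) :
    ∃ o, (curve (n + m)).IsValidOrdering o ∧
      ∀ a b, e a < e b ↔ o (Curve.lift μ a) < o (Curve.lift μ b) := by
  induction m with
  | zero =>
    have hid : μ = id := (StrictMono.range_inj hμ strictMono_id).mp (by
      rw [Set.range_id, (Finite.injective_iff_surjective.mp hμ.injective).range_eq])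
    have hl : ∀ a, Curve.lift μ a = a := fun a => by
      ext j
      rw [hid, Curve.lift]
      exact congrArg _ (Function.injective_id.extend_apply a 0 j)
    exact ⟨e, he, fun a b => by rw [hl, hl]⟩
  | succ m ih =>
    obtain ⟨c, hc⟩ : ∃ c, ∀ x, μ x ≠ c := by
      by_contra! hcon
      have := Fintype.card_le_of_surjective μ hcon
      simp at this
    have hex : ∀ x, ∃ y : Fin (n + m), c.succAbove y = μ x := fun x => Fin.exists_succAbove_eq (hc x)
    choose ν hν using hex
    have hνm : StrictMono ν := fun x y hxy => by
      rw [← Fin.succAbove_lt_succAbove_iff (p := c), hν, hν]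
      exact hμ hxy
    obtain ⟨o, ho, hoe⟩ := ih ν hνm
    obtain ⟨Φ, h1, h2⟩ := exists_strictMono_front (n := n + m) (by omega) c
    obtain ⟨o', ho', hoe'⟩ := Curve.exists_isValidOrdering_of_face h2 ho
    have hl : ∀ a : Fin n → I, (Curve.lift μ a : Fin (n + m + 1) → I) c = 0 ∧
        c.removeNth (Curve.lift μ a) = Curve.lift ν a := by
      intro a
      constructor
      · rw [Curve.lift, Function.extend_apply' _ _ _ (by rintro ⟨x, hx⟩; exact hc x hx)]
        rfl
      · funext y
        rw [Fin.removeNth, Curve.lift, Curve.lift]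
        by_cases hy : ∃ x, ν x = y
        · obtain ⟨x, rfl⟩ := hy
          rw [hν, hμ.injective.extend_apply, hνm.injective.extend_apply]
        · rw [Function.extend_apply' _ _ _ hy, Function.extend_apply']
          · rfl
          · rintro ⟨x, hx⟩
            rw [← hν] at hx
            exact hy ⟨x, Fin.succAbove_right_injective hx⟩
    refine ⟨o', ho', fun a b => ?_⟩
    rw [hoe' _ (hl a).1, hoe' _ (hl b).1, (hl a).2, (hl b).2, h1.lt_iff_lt, hoe]

theorem interdimensionallyConsistent : InterdimensionallyConsistent harmoniousHilbert := by
  refine ⟨fun d _ => ⟨curve d, curve_mem d, fun f hf => eq_curve_of_mem hf⟩, ?_⟩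
  intro i j hi hij f hf f' hf'
  obtain ⟨m, rfl⟩ := Nat.exists_eq_add_of_lt hij
  rw [eq_curve_of_mem hf, eq_curve_of_mem hf']
  intro e he μ hμ
  exact exists_isValidOrdering_lift hi (m + 1) he μ hμ

end Harmonious
end SpaceFilling

theorem mainTheorem1 :
    (∀ d : ℕ, 1 ≤ d →
      (SpaceFilling.harmoniousOrder d).IsRegular 2 ∧
      (SpaceFilling.harmoniousOrder d).IsMono ∧
      (SpaceFilling.harmoniousOrder d).IsOrderPreserving ∧
      (SpaceFilling.harmoniousOrder d).IsVertexContinuous ∧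
      (SpaceFilling.harmoniousOrder d).HasNeutralOrientation) ∧
    SpaceFilling.InterdimensionallyConsistent SpaceFilling.harmoniousHilbert ∧
    (∀ n : ℕ, 1 ≤ n →
      ∀ f ∈ SpaceFilling.harmoniousHilbert n, ∀ g ∈ SpaceFilling.harmoniousHilbert (n + 1),
        (∀ i : Fin (n + 1), g.Shows f i 0) ∧
        (∀ i : Fin n, g.Shows (f.mirror i) i.castSucc 1)) := by
  refine ⟨fun d hd => ?_, SpaceFilling.Harmonious.interdimensionallyConsistent, ?_⟩
  · have hmono : (SpaceFilling.harmoniousOrder d).IsMono := Nat.card_unique (α := Unit)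
    exact ⟨SpaceFilling.Harmonious.isRegular d, hmono, ⟨hmono, fun _ _ => rfl⟩,
      SpaceFilling.Harmonious.isVertexContinuous d,
      SpaceFilling.Harmonious.hasNeutralOrientation hd⟩
  · intro n hn f hf g hg
    rw [SpaceFilling.Harmonious.eq_curve_of_mem hf, SpaceFilling.Harmonious.eq_curve_of_mem hg]
    exact ⟨SpaceFilling.Harmonious.curve_shows_front hn,
      SpaceFilling.Harmonious.curve_shows_back hn⟩
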